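/- **Theorem 4.3.** Let $t_0<t_1$, $x_0\in\mathbb R^m$, and consider the $n$-player interval differential game with state equation $\dot x(t)=f(t,x(t),u_1(t),\dots,u_n(t))$, $x(t_0)=x_0$, on $[t_0,t_1]$ and interval payoffs $$J_i(u_1,\dots,u_n)=\psi_i(x(t_1))+\int_{t_0}^{t_1}L_i(t,x(t),u_1(t),\dots,u_n(t))\,dt ,\qquad i=1,\dots,n,$$ where $f:[t_0,t_1]\times\mathbb R^m\times\mathbb R^{m_1}\times\dots\times\mathbb R^{m_n}\to\mathbb R^m$, where $\psi_i=[\underline\psi_i,\overline\psi_i]$ and $L_i=[\underline L_i,\overline L_i]$ take values in the compact intervals of $\mathbb R$, where the integral is the Aumann integral, and where player $i$ chooses $u_i$ in a set $U_i\subset C([t_0,t_1];\mathbb R^{m_i})$ of permissible controls. A state corresponding to $u=(u_1,\dots,u_n)$ is a solution $x$ of the state equation on the whole of $[t_0,t_1]$. Assume that $f$ is continuous, that $f$, $\underline L_i$ and $\overline L_i$ have partial derivatives with respect to $x$ and each $u_k$ which are continuous in $(t,x,u_1,\dots,u_n)$, that $\underline L_i$ and $\overline L_i$ are integrable in $t$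 along all continuous states and controls, and that $\underline\psi_i$ and $\overline\psi_i$ are differentiable. Let $(u_1^*,\dots,u_n^*)\in U_1\times\dots\times U_n$, with corresponding state $x^*$, be an open-loop Pareto–Nash equilibrium: for each $i$ and each $u_i\in U_i$ (such that $(u_i,u_{-i}^*)$ has a corresponding state), $$\underline J_i(u_i^*,u_{-i}^*)\ge\underline J_i(u_i,u_{-i}^*)\quad\text{or}\quad \overline J_i(u_i^*,u_{-i}^*)\ge\overline J_i(u_i,u_{-i}^*).$$ Assume that no control constraint is active at the equilibrium, in the sense that for each $i$ the set of those $v\in C([t_0,t_1];\mathbb R^{m_i})$ for which $u_i^*+sv\in U_i$ for all sufficiently small $s>0$ is dense in $C([t_0,t_1];\mathbb R^{m_i})$ for the maximum norm (this holds, for instance, if $U_i=C([t_0,t_1];\mathbb R^{m_i})$ or if $u_i^*$ is an interior point of $U_i$). Then there exist $p_i\in C^1([t_0,t_1];\mathbb R^m)$, $i=1,\dots,n$, such that, with the interval-valued Hamiltonians $H_i(t,x,u_1,\dots,u_n,p)=L_i(t,x,u_1,\dots,u_n)+p^Tf(t,x,u_1,\dots,u_n)$, for all $i$ and all $t\in[t_0,t_1]$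 the following $gH$-partial derivatives exist and $$\dot x^*(t)=f(t,x^*(t),u_1^*(t),\dots,u_n^*(t)),\qquad x^*(t_0)=x_0,$$ $$\dot p_i(t)\in-\Big(\frac{\partial H_i}{\partial x}\Big)_{gH}(t,x^*(t),u_1^*(t),\dots,u_n^*(t),p_i(t)),$$ $$0\in\Big(\frac{\partial H_i}{\partial u_i}\Big)_{gH}(t,x^*(t),u_1^*(t),\dots,u_n^*(t),p_i(t)),$$ $$p_i(t_1)\in\nabla_{gH}\psi_i(x^*(t_1)).$$ Here, with $A\ominus_{gH}B=[\min\{\underline a-\underline b,\overline a-\overline b\},\max\{\underline a-\underline b,\overline a-\overline b\}]$, the $gH$-derivative of an interval-valued function $F$ of one real variable at $s$ is $\lim_{h\to0}\frac1h\,(F(s+h)\ominus_{gH}F(s))$ (convergence of both end-points). The $gH$-derivatives with respect to the vectors $x$ and $u_i$, and $\nabla_{gH}$, are the interval vectors of the coordinatewise $gH$-derivatives, and membership of a vector in an interval vector is componentwise. -/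

import Mathlib

open Set Filter Topology MeasureTheory
open scoped Pointwise

noncomputable section

namespace IntervalGame

/-! ### Compact intervals and the generalized Hukuhara derivative -/

/-- The generalized Hukuhara difference of two compact intervals of real numbers. -/
def gHSub (A B : NonemptyInterval ℝ) : NonemptyInterval ℝ :=
  ⟨(min (A.fst - B.fst) (A.snd - B.snd), max (A.fst - B.fst) (A.snd - B.snd)), min_le_max⟩

/-- The product `c • A` of a compact interval with a real number (of either sign). -/
def scale (c : ℝ) (A : NonemptyInterval ℝ) : NonemptyInterval ℝ :=
  ⟨(min (c * A.fst) (c * A.snd), max (c * A.fst) (c * A.snd)), min_le_max⟩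

/-- Convergence of compact intervals in the Hausdorff metric
`d([a, b], [c, d]) = max |a - c| |b - d|`, that is, convergence of both end-points. -/
def IntervalTendsto {α : Type*} (F : α → NonemptyInterval ℝ) (l : Filter α)
    (A : NonemptyInterval ℝ) : Prop :=
  Tendsto (fun a => (F a).fst) l (𝓝 A.fst) ∧ Tendsto (fun a => (F a).snd) l (𝓝 A.snd)

/-- `A` is the gH-derivative of `F` at `t`, the limit of `(F (t + h) ⊖ F t) / h` as `h → 0`. -/
def HasGHDerivAt (F : ℝ → NonemptyInterval ℝ) (A : NonemptyInterval ℝ) (t : ℝ) : Prop :=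
  IntervalTendsto (fun h : ℝ => scale h⁻¹ (gHSub (F (t + h)) (F t))) (𝓝[≠] 0) A

/-- The interval vector `A` is the gH-gradient of `F` at `x`: for each `j`, the component `A j`
is the gH-partial derivative of `F` with respect to the `j`-th coordinate. -/
def HasGHGradientAt {d : ℕ} (F : EuclideanSpace ℝ (Fin d) → NonemptyInterval ℝ)
    (A : Fin d → NonemptyInterval ℝ) (x : EuclideanSpace ℝ (Fin d)) : Prop :=
  ∀ j : Fin d,
    HasGHDerivAt (fun s : ℝ => F (WithLp.toLp 2 (Function.update x.ofLp j s))) (A j) (x j)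

/-- End-point differentiability of an interval-valued function of several variables. -/
def EDifferentiableAt {d : ℕ} (F : EuclideanSpace ℝ (Fin d) → NonemptyInterval ℝ)
    (x : EuclideanSpace ℝ (Fin d)) : Prop :=
  DifferentiableAt ℝ (fun y => (F y).fst) x ∧ DifferentiableAt ℝ (fun y => (F y).snd) x

/-- The Aumann integral of `F` over `[a, b]`: the set of integrals of integrable selections. -/
def aumannIntegral (F : ℝ → NonemptyInterval ℝ) (a b : ℝ) : Set ℝ :=
  {y | ∃ g : ℝ → ℝ, IntervalIntegrable g volume a b ∧
    (∀ᵐ t ∂(volume.restrict (Icc a b)), g t ∈ F t) ∧ y = ∫ t in a..b, g t}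

/-! ### Interval differential games -/

/-- The joint control values of the `n` players, player `k` acting in dimension `d k`. -/
abbrev Controls {n : ℕ} (d : Fin n → ℕ) : Type :=
  ∀ k : Fin n, EuclideanSpace ℝ (Fin (d k))

/-- On `T × ℝᵐ × ∏ ℝ^(d k)`, the function `g t x u` has partial derivatives with respect to `x`
and to each `u k`, and these are jointly continuous in `(t, x, u)`. -/
def HasContinuousPartials {n m : ℕ} {d : Fin n → ℕ} {F : Type*} [NormedAddCommGroup F]
    [NormedSpace ℝ F] (T : Set ℝ)
    (g : ℝ → EuclideanSpace ℝ (Fin m) → Controls d → F) : Prop :=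
  (∃ gx : ℝ × EuclideanSpace ℝ (Fin m) × Controls d → EuclideanSpace ℝ (Fin m) →L[ℝ] F,
    ContinuousOn gx (T ×ˢ univ) ∧
    ∀ t ∈ T, ∀ x u, HasFDerivAt (fun y => g t y u) (gx (t, x, u)) x) ∧
  ∀ k : Fin n,
    ∃ gu : ℝ × EuclideanSpace ℝ (Fin m) × Controls d → EuclideanSpace ℝ (Fin (d k)) →L[ℝ] F,
      ContinuousOn gu (T ×ˢ univ) ∧
      ∀ t ∈ T, ∀ x u,
        HasFDerivAt (fun w => g t x (Function.update u k w)) (gu (t, x, u)) (u k)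

/-- The data of an `n`-player interval differential game with state space `ℝᵐ`. The functions
`f` and `L` are only ever evaluated at times in `[t₀, t₁]`. -/
structure Game (n m : ℕ) (d : Fin n → ℕ) where
  /-- initial time -/
  t₀ : ℝ
  /-- terminal time -/
  t₁ : ℝ
  t₀_lt_t₁ : t₀ < t₁
  /-- initial state -/
  x₀ : EuclideanSpace ℝ (Fin m)
  /-- right-hand side of the state equation -/
  f : ℝ → EuclideanSpace ℝ (Fin m) → Controls d → EuclideanSpace ℝ (Fin m)
  /-- terminal payoffs -/
  ψ : Fin n → EuclideanSpace ℝ (Fin m) → NonemptyInterval ℝ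
  /-- integral payoffs -/
  L : Fin n → ℝ → EuclideanSpace ℝ (Fin m) → Controls d → NonemptyInterval ℝ
  /-- sets of permissible controls, inside `C([t₀, t₁]; ℝ^(d k))` -/
  U : ∀ k : Fin n, Set C(Icc t₀ t₁, EuclideanSpace ℝ (Fin (d k)))

namespace Game

variable {n m : ℕ} {d : Fin n → ℕ}

/-- Open-loop control profiles: a continuous control on `[t₀, t₁]` for each player. -/
abbrev Profile (G : Game n m d) : Type :=
  ∀ k : Fin n, C(Icc G.t₀ G.t₁, EuclideanSpace ℝ (Fin (d k)))

/-- The joint control value at time `t ∈ [t₀, t₁]` (constantly extended outside). -/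
def value (G : Game n m d) (u : G.Profile) (t : ℝ) : Controls d :=
  fun k => u k (projIcc G.t₀ G.t₁ G.t₀_lt_t₁.le t)

/-- `x` is a state corresponding to `u`: `x' = f(t, x, u)` on `[t₀, t₁]` and `x(t₀) = x₀`, with
one-sided derivatives at the end-points. -/
def IsState (G : Game n m d) (u : G.Profile) (x : ℝ → EuclideanSpace ℝ (Fin m)) : Prop :=
  x G.t₀ = G.x₀ ∧
  ∀ t ∈ Icc G.t₀ G.t₁, HasDerivWithinAt x (G.f t (x t) (G.value u t)) (Icc G.t₀ G.t₁) t

/-- The interval payoff `J i = ψ i (x(t₁)) + ∫ L i (t, x(t), u(t)) dt`, as a set of reals. -/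
def payoff (G : Game n m d) (i : Fin n) (u : G.Profile) (x : ℝ → EuclideanSpace ℝ (Fin m)) :
    Set ℝ :=
  (G.ψ i (x G.t₁) : Set ℝ) + aumannIntegral (fun t => G.L i t (x t) (G.value u t)) G.t₀ G.t₁

/-- The lower end-point of the interval payoff. -/
def lowerPayoff (G : Game n m d) (i : Fin n) (u : G.Profile)
    (x : ℝ → EuclideanSpace ℝ (Fin m)) : ℝ :=
  sInf (G.payoff i u x)

/-- The upper end-point of the interval payoff. -/
def upperPayoff (G : Game n m d) (i : Fin n) (u : G.Profile)
    (x : ℝ → EuclideanSpace ℝ (Fin m)) : ℝ :=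
  sSup (G.payoff i u x)

/-- `u`, with corresponding state `x`, is an open-loop Pareto-Nash equilibrium: no player can, by
switching to another permissible control (one that generates a state on `[t₀, t₁]`), raise
both end-points of the interval payoff strictly. -/
def IsParetoNash (G : Game n m d) (u : G.Profile) (x : ℝ → EuclideanSpace ℝ (Fin m)) : Prop :=
  (∀ i, u i ∈ G.U i) ∧ G.IsState u x ∧
  ∀ i, ∀ v ∈ G.U i, ∀ y, G.IsState (Function.update u i v) y →
    G.lowerPayoff i (Function.update u i v) y ≤ G.lowerPayoff i u x ∨
    G.upperPayoff i (Function.update u i v) y ≤ G.upperPayoff i u x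

/-- The interval-valued Hamiltonian `H i = L i + pᵀ f` of player `i`. -/
def hamiltonian (G : Game n m d) (i : Fin n) (t : ℝ) (x : EuclideanSpace ℝ (Fin m))
    (u : Controls d) (p : EuclideanSpace ℝ (Fin m)) : NonemptyInterval ℝ :=
  G.L i t x u + NonemptyInterval.pure (inner ℝ p (G.f t x u))

/-- All integral payoffs are well defined: along continuous states and controls, the end-points
of `L i (t, x(t), u(t))` are integrable on `[t₀, t₁]`. -/
def PayoffsIntegrable (G : Game n m d) : Prop :=
  ∀ i, ∀ x : ℝ → EuclideanSpace ℝ (Fin m), ContinuousOn x (Icc G.t₀ G.t₁) → ∀ u : G.Profile,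
    IntervalIntegrable (fun t => (G.L i t (x t) (G.value u t)).fst) volume G.t₀ G.t₁ ∧
    IntervalIntegrable (fun t => (G.L i t (x t) (G.value u t)).snd) volume G.t₀ G.t₁

/-- The directions `v` in which the control `w` of player `i` can be perturbed inside `U i`:
`w + s v ∈ U i` for all sufficiently small `s > 0`. -/
def feasibleDirections (G : Game n m d) (i : Fin n)
    (w : C(Icc G.t₀ G.t₁, EuclideanSpace ℝ (Fin (d i)))) :
    Set C(Icc G.t₀ G.t₁, EuclideanSpace ℝ (Fin (d i))) :=
  {v | ∀ᶠ s : ℝ in 𝓝[>] 0, w + s • v ∈ G.U i}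

/-- No control constraint is active at the control `w` of player `i`: the feasible directions are
dense in `C([t₀, t₁]; ℝ^(d i))` with the maximum norm. This holds at every control if `U i` is
the whole space, and at every interior point of `U i`. -/
def ControlUnconstrainedAt (G : Game n m d) (i : Fin n)
    (w : C(Icc G.t₀ G.t₁, EuclideanSpace ℝ (Fin (d i)))) : Prop :=
  Dense (G.feasibleDirections i w)

end Game

end IntervalGame

end

/-!
A multiplier argument reduces the interval-valued game to a classical adjoint calculation. Fix a
player `i` and freeze the controls of the others. The end-points of the payoff are two real
functionals, `ψ(x(t₁)) + ∫ L dt` with the end-points of `ψ` and `L` (`Game.lowerPayoff_eq`,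
`Game.upperPayoff_eq`). Along a feasible direction `v` the perturbed control `u i + s • v` generates
a state on the whole of `[t₀, t₁]` at distance `O(s)` from the equilibrium state
(`exists_perturbed_state`): truncate the vector field to a tube around the equilibrium state, solve
the truncated equation by Picard-Lindelöf, and use Grönwall's inequality to see that the solution
never feels the truncation. Each end-point functional then has a one-sided derivative in `s`, equal
to `∫ ⟪g, v⟫ dt` with `g = L_uᵀ + f_uᵀ p`, where `p` solves the adjoint equation for that end-point
(`exists_adjoint_trajectory`, `exists_first_variation_bound`).

If some `v` made both integrals positive, so would a feasible one, feasible directions being dense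
and the integrals continuous in `v`; a short step along it would raise both end-points of the
payoff, against the equilibrium property (`Game.not_both_pairings_pos`). By Gordan's alternative
(`exists_convexCombination_eq_zero`) a convex combination `c g₁ + (1 - c) g₂` of the two gradients
represents the zero functional, hence vanishes identically (`eq_zero_of_pairing_self`).

The costate is `p = c p₁ + (1 - c) p₂`. Where both end-points are differentiable, the gH-derivative
of an interval-valued function is the interval spanned by the two derivatives
(`hasGHDerivAt_of_hasDerivAt`), so it contains their convex combination with weights `c` and
`1 - c`. The classical adjoint equation, stationarity and transversality condition of the weighted
problem are therefore the asserted inclusions.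
-/

namespace IntervalGame

/-! ### Linear alternatives -/

/-- Gordan's theorem for two linear functionals: if no vector makes both of them positive, then a
convex combination of them vanishes. -/
theorem exists_convexCombination_eq_zero {V : Type*} [AddCommGroup V] [Module ℝ V]
    (φ χ : V →ₗ[ℝ] ℝ) (h : ∀ v, ¬(0 < φ v ∧ 0 < χ v)) :
    ∃ c : ℝ, 0 ≤ c ∧ c ≤ 1 ∧ ∀ v, c * φ v + (1 - c) * χ v = 0 := by
  by_cases hφ : ∀ v, φ v = 0
  · exact ⟨1, zero_le_one, le_rfl, fun v => by simp [hφ v]⟩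
  push Not at hφ
  obtain ⟨w, hw⟩ := hφ
  set e := (φ w)⁻¹ • w with he
  have hφe : φ e = 1 := by simp [he, hw]
  -- The functional `χ` is determined by `φ`: otherwise some `k` in the kernel of `φ` has
  -- `χ k ≠ 0`, and a vector `e + r • k` makes both functionals positive.
  have hker : ∀ k, φ k = 0 → χ k = 0 := by
    intro k hk
    by_contra hχ
    refine h (e + ((1 - χ e) / χ k) • k) ⟨?_, ?_⟩
    · simp [hφe, hk]
    · simp [hχ]
  have hχ : ∀ v, χ v = χ e * φ v := by
    intro v
    have := hker (v - φ v • e) (by simp [hφe])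
    simp only [map_sub, map_smul, smul_eq_mul] at this
    linarith
  have hneg : χ e ≤ 0 := by
    by_contra hpos
    exact h e ⟨by rw [hφe]; exact one_pos, not_le.mp hpos⟩
  have hden : 0 < 1 - χ e := by linarith
  refine ⟨-χ e / (1 - χ e), by apply div_nonneg <;> linarith,
    (div_le_one hden).2 (by linarith), fun v => ?_⟩
  rw [hχ v]
  field_simp
  ring

/-! ### Truncation and global solutions of differential equations -/

/-- The coordinatewise truncation of a vector to the cube `[-R, R]ᵐ`. -/
noncomputable def clamp {m : ℕ} (R : ℝ) (z : EuclideanSpace ℝ (Fin m)) :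
    EuclideanSpace ℝ (Fin m) :=
  WithLp.toLp 2 fun j => max (-R) (min R (z j))

theorem lipschitzWith_clamp {m : ℕ} (R : ℝ) :
    LipschitzWith 1 (clamp R : EuclideanSpace ℝ (Fin m) → EuclideanSpace ℝ (Fin m)) := by
  refine LipschitzWith.of_dist_le_mul fun y z => ?_
  rw [NNReal.coe_one, one_mul, EuclideanSpace.dist_eq, EuclideanSpace.dist_eq]
  refine Real.sqrt_le_sqrt (Finset.sum_le_sum fun j _ => ?_)
  refine pow_le_pow_left₀ dist_nonneg ?_ 2
  simp only [clamp, Real.dist_eq]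
  calc |max (-R) (min R (y j)) - max (-R) (min R (z j))| ≤ |min R (y j) - min R (z j)| := by
        simpa using abs_max_sub_max_le_max (-R) (min R (y j)) (-R) (min R (z j))
    _ ≤ |y j - z j| := by simpa using abs_min_sub_min_le_max R (y j) R (z j)

theorem clamp_of_norm_le {m : ℕ} {R : ℝ} {z : EuclideanSpace ℝ (Fin m)} (hz : ‖z‖ ≤ R) :
    clamp R z = z := by
  ext j
  have h := (PiLp.norm_apply_le z j).trans hz
  rw [Real.norm_eq_abs, abs_le] at h
  simp [clamp, h.1, h.2]

theorem norm_clamp_le {m : ℕ} {R : ℝ} (hR : 0 ≤ R) (z : EuclideanSpace ℝ (Fin m)) :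
    ‖clamp R z‖ ≤ ‖z‖ := by
  have h0 : clamp R (0 : EuclideanSpace ℝ (Fin m)) = 0 := clamp_of_norm_le (by simpa using hR)
  simpa [h0] using (lipschitzWith_clamp R).dist_le_mul z 0

theorem norm_clamp_le_radius {m : ℕ} {R : ℝ} (hR : 0 ≤ R) (z : EuclideanSpace ℝ (Fin m)) :
    ‖clamp R z‖ ≤ √m * R := by
  rw [EuclideanSpace.norm_eq]
  have : ∑ j, ‖clamp R z j‖ ^ 2 ≤ m * R ^ 2 := by
    calc ∑ j, ‖clamp R z j‖ ^ 2 ≤ ∑ _j : Fin m, R ^ 2 := by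
          refine Finset.sum_le_sum fun j _ => pow_le_pow_left₀ (norm_nonneg _) ?_ 2
          rw [Real.norm_eq_abs, abs_le]
          exact ⟨le_max_left _ _, max_le (by linarith) (min_le_left _ _)⟩
      _ = m * R ^ 2 := by simp
  calc √(∑ j, ‖clamp R z j‖ ^ 2) ≤ √(m * R ^ 2) := Real.sqrt_le_sqrt this
    _ = √m * R := by rw [Real.sqrt_mul (Nat.cast_nonneg m), Real.sqrt_sq hR]

/-- A bounded, globally Lipschitz vector field has a solution on the whole time interval. -/
theorem exists_solution_of_bounded {E : Type*} [NormedAddCommGroup E] [NormedSpace ℝ E]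
    [CompleteSpace E] {a b : ℝ} (hab : a ≤ b) {F : ℝ → E → E} {K : NNReal} {M : ℝ}
    (hK : ∀ t ∈ Icc a b, LipschitzWith K (F t))
    (hF : ∀ y, ContinuousOn (fun t => F t y) (Icc a b))
    (hM : ∀ t ∈ Icc a b, ∀ y, ‖F t y‖ ≤ M) (x₀ : E) :
    ∃ y : ℝ → E, y a = x₀ ∧ ∀ t ∈ Icc a b, HasDerivWithinAt y (F t (y t)) (Icc a b) t := by
  have hpl : IsPicardLindelof F (⟨a, left_mem_Icc.2 hab⟩ : Icc a b) x₀
      (M.toNNReal * (b - a).toNNReal) 0 M.toNNReal K :=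
    { lipschitzOnWith := fun t ht => (hK t ht).lipschitzOnWith
      continuousOn := fun y _ => hF y
      norm_le := fun t ht y _ => (hM t ht y).trans (Real.le_coe_toNNReal M)
      mul_max_le := by
        have : 0 ≤ b - a := sub_nonneg.2 hab
        simp [this] }
  exact hpl.exists_eq_forall_mem_Icc_hasDerivWithinAt₀

/-- Grönwall's inequality for derivatives within a compact interval. -/
theorem norm_le_gronwallBound {E : Type*} [NormedAddCommGroup E] [NormedSpace ℝ E]
    {a b δ K ε : ℝ} (hδ : 0 ≤ δ) (hK : 0 ≤ K) (hε : 0 ≤ ε) {y y' : ℝ → E}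
    (hy : ∀ t ∈ Icc a b, HasDerivWithinAt y (y' t) (Icc a b) t) (ha : ‖y a‖ ≤ δ)
    (hbound : ∀ t ∈ Icc a b, ‖y' t‖ ≤ K * ‖y t‖ + ε) :
    ∀ t ∈ Icc a b, ‖y t‖ ≤ gronwallBound δ K ε (b - a) := by
  intro t ht
  refine (norm_le_gronwallBound_of_norm_deriv_right_le
    (fun t ht => (hy t ht).continuousWithinAt) (fun t ht => ?_) ha
    (fun t ht => hbound t (Ico_subset_Icc_self ht)) t ht).trans
    (gronwallBound_mono hδ hε hK (by linarith [ht.2]))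
  exact ((hy t (Ico_subset_Icc_self ht)).mono_of_mem_nhdsWithin (Icc_mem_nhdsGE_of_mem ht))

/-- A vector field truncated to a cube around a continuous curve `ξ` has a solution on the whole
time interval. -/
theorem exists_truncated_solution {m : ℕ} {a b : ℝ} (hab : a ≤ b)
    {F : ℝ → EuclideanSpace ℝ (Fin m) → EuclideanSpace ℝ (Fin m)}
    (hF : ContinuousOn (Function.uncurry F) (Icc a b ×ˢ univ))
    {ξ : ℝ → EuclideanSpace ℝ (Fin m)} (hξ : ContinuousOn ξ (Icc a b)) {R : ℝ} (hR : 0 ≤ R)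
    {K : NNReal}
    (hK : ∀ t ∈ Icc a b, LipschitzOnWith K (F t) (Metric.closedBall (ξ t) (√m * R)))
    (x₀ : EuclideanSpace ℝ (Fin m)) :
    ∃ y : ℝ → EuclideanSpace ℝ (Fin m), y a = x₀ ∧ ∀ t ∈ Icc a b,
      HasDerivWithinAt y (F t (ξ t + clamp R (y t - ξ t))) (Icc a b) t := by
  have hcont : ContinuousOn (fun q : ℝ × EuclideanSpace ℝ (Fin m) => F q.1 (ξ q.1 + q.2))
      (Icc a b ×ˢ univ) := by
    refine hF.comp (f := fun q : ℝ × EuclideanSpace ℝ (Fin m) => (q.1, ξ q.1 + q.2))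
      (continuousOn_fst.prodMk ((hξ.comp continuousOn_fst fun q hq => hq.1).add
        continuousOn_snd)) fun q hq => ⟨hq.1, mem_univ _⟩
  obtain ⟨M, hM⟩ := (isCompact_Icc.prod (isCompact_closedBall (0 : EuclideanSpace ℝ (Fin m))
    (√m * R))).exists_bound_of_continuousOn
      (hcont.mono (prod_mono_right (subset_univ _)))
  refine exists_solution_of_bounded hab
    (F := fun t y => F t (ξ t + clamp R (y - ξ t))) (K := K) (M := M) ?_ ?_ ?_ x₀
  · intro t ht
    have h1 : LipschitzWith 1 fun y => ξ t + clamp R (y - ξ t) := by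
      refine LipschitzWith.of_dist_le_mul fun y z => ?_
      simpa using (lipschitzWith_clamp R).dist_le_mul (y - ξ t) (z - ξ t)
    have h2 := (hK t ht).comp (h1.lipschitzOnWith (s := univ)) fun y _ => by
      simpa [Metric.mem_closedBall, dist_eq_norm] using norm_clamp_le_radius hR (y - ξ t)
    rw [mul_one, lipschitzOnWith_univ] at h2
    exact h2
  · intro y
    refine hcont.comp (f := fun t => (t, clamp R (y - ξ t))) (continuousOn_id.prodMk
      ((lipschitzWith_clamp R).continuous.comp_continuousOn (continuousOn_const.sub hξ)))
      fun t ht => ⟨ht, mem_univ _⟩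
  · intro t ht y
    exact hM (t, clamp R (y - ξ t)) ⟨ht, by simpa using norm_clamp_le_radius hR _⟩

/-- A linear differential equation with continuous coefficients has a solution on the whole time
interval for each initial value. -/
theorem exists_linear_solution {m : ℕ} {a b : ℝ} (hab : a ≤ b)
    {A : ℝ → EuclideanSpace ℝ (Fin m) →L[ℝ] EuclideanSpace ℝ (Fin m)}
    {c : ℝ → EuclideanSpace ℝ (Fin m)}
    (hA : ContinuousOn A (Icc a b)) (hc : ContinuousOn c (Icc a b))
    (x₀ : EuclideanSpace ℝ (Fin m)) :
    ∃ y : ℝ → EuclideanSpace ℝ (Fin m), y a = x₀ ∧ ∀ t ∈ Icc a b,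
      HasDerivWithinAt y (A t (y t) + c t) (Icc a b) t := by
  obtain ⟨K, hK⟩ := isCompact_Icc.exists_bound_of_continuousOn hA
  obtain ⟨N, hN⟩ := isCompact_Icc.exists_bound_of_continuousOn hc
  have hK0 : 0 ≤ K := (norm_nonneg _).trans (hK a (left_mem_Icc.2 hab))
  have hN0 : 0 ≤ N := (norm_nonneg _).trans (hN a (left_mem_Icc.2 hab))
  -- The a priori bound is independent of the truncation, since truncation shrinks norms.
  set R := gronwallBound ‖x₀‖ K N (b - a) with hR
  have hR0 : 0 ≤ R := by
    refine (norm_nonneg x₀).trans ?_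
    rw [hR, ← gronwallBound_x0 ‖x₀‖ K N]
    conv_rhs => rw [gronwallBound_x0 ‖x₀‖ K N]
    exact gronwallBound_mono (norm_nonneg _) hN0 hK0 (sub_nonneg.2 hab)
  have h1 : MapsTo Prod.fst (Icc a b ×ˢ (univ : Set (EuclideanSpace ℝ (Fin m)))) (Icc a b) :=
    fun q hq => hq.1
  have hF : ContinuousOn (Function.uncurry fun t y => A t y + c t) (Icc a b ×ˢ univ) :=
    ((hA.comp continuousOn_fst h1).clm_apply continuousOn_snd).add (hc.comp continuousOn_fst h1)
  have hlip : ∀ t ∈ Icc a b, LipschitzOnWith K.toNNReal (fun y => A t y + c t)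
      (Metric.closedBall 0 (√m * R)) := by
    intro t ht
    refine LipschitzWith.lipschitzOnWith (LipschitzWith.of_dist_le_mul fun y z => ?_)
    rw [dist_add_right, dist_eq_norm, ← map_sub, dist_eq_norm, Real.coe_toNNReal _ hK0]
    exact ((A t).le_opNorm _).trans (mul_le_mul_of_nonneg_right (hK t ht) (norm_nonneg _))
  obtain ⟨y, hya, hy⟩ := exists_truncated_solution hab hF (ξ := fun _ => 0) continuousOn_const
    hR0 hlip x₀
  simp only [zero_add, sub_zero] at hy
  refine ⟨y, hya, fun t ht => ?_⟩
  have hb := norm_le_gronwallBound (norm_nonneg x₀) hK0 hN0 hy (by rw [hya]) fun t ht => by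
    refine (norm_add_le _ _).trans (add_le_add ?_ (hN t ht))
    refine ((A t).le_opNorm _).trans ?_
    exact mul_le_mul (hK t ht) (norm_clamp_le hR0 _) (norm_nonneg _) hK0
  have := hy t ht
  rwa [clamp_of_norm_le (hb t ht)] at this

/-- A linear differential equation with continuous coefficients has a solution on the whole time
interval for each terminal value. -/
theorem exists_linear_solution_terminal {m : ℕ} {a b : ℝ} (hab : a ≤ b)
    {A : ℝ → EuclideanSpace ℝ (Fin m) →L[ℝ] EuclideanSpace ℝ (Fin m)}
    {c : ℝ → EuclideanSpace ℝ (Fin m)}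
    (hA : ContinuousOn A (Icc a b)) (hc : ContinuousOn c (Icc a b))
    (x₁ : EuclideanSpace ℝ (Fin m)) :
    ∃ y : ℝ → EuclideanSpace ℝ (Fin m), y b = x₁ ∧ ∀ t ∈ Icc a b,
      HasDerivWithinAt y (A t (y t) + c t) (Icc a b) t := by
  have hr : MapsTo (fun t => a + b - t) (Icc a b) (Icc a b) :=
    fun t ht => ⟨by linarith [ht.2], by linarith [ht.1]⟩
  have hrc : ContinuousOn (fun t : ℝ => a + b - t) (Icc a b) := by fun_prop
  obtain ⟨y, hya, hy⟩ := exists_linear_solution hab (hA.comp hrc hr).neg (hc.comp hrc hr).neg x₁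
  refine ⟨fun t => y (a + b - t), by simpa using hya, fun t ht => ?_⟩
  have h1 : HasDerivWithinAt (fun t : ℝ => a + b - t) (-1) (Icc a b) t := by
    simpa using (hasDerivWithinAt_id t (Icc a b)).const_sub (a + b)
  have h2 := HasDerivWithinAt.scomp t (hy _ (hr ht)) h1 hr
  refine h2.congr_deriv ?_
  simp [add_comm]

/-! ### Uniform estimates along a continuous trajectory -/

section Estimates

variable {E W F : Type*} [NormedAddCommGroup E] [NormedAddCommGroup W] [NormedAddCommGroup F]

theorem continuousOn_translate {T : Set ℝ} {h : ℝ × E × W → F} (hh : ContinuousOn h (T ×ˢ univ))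
    {ξ : ℝ → E} {ω : ℝ → W} (hξ : ContinuousOn ξ T) (hω : ContinuousOn ω T) :
    ContinuousOn (fun q : ℝ × E × W => h (q.1, ξ q.1 + q.2.1, ω q.1 + q.2.2)) (T ×ˢ univ) := by
  have h1 : MapsTo Prod.fst (T ×ˢ (univ : Set (E × W))) T := fun q hq => hq.1
  refine hh.comp (f := fun q : ℝ × E × W => (q.1, ξ q.1 + q.2.1, ω q.1 + q.2.2))
    (continuousOn_fst.prodMk (ContinuousOn.prodMk ?_ ?_)) fun q hq => ⟨hq.1, mem_univ _⟩
  · exact (hξ.comp continuousOn_fst h1).add (continuous_fst.comp continuous_snd).continuousOn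
  · exact (hω.comp continuousOn_fst h1).add (continuous_snd.comp continuous_snd).continuousOn

theorem continuousOn_along {T : Set ℝ} {h : ℝ × E × W → F} (hh : ContinuousOn h (T ×ˢ univ))
    {ξ : ℝ → E} {ω : ℝ → W} (hξ : ContinuousOn ξ T) (hω : ContinuousOn ω T) :
    ContinuousOn (fun t => h (t, ξ t, ω t)) T :=
  hh.comp (f := fun t => (t, ξ t, ω t)) (continuousOn_id.prodMk (hξ.prodMk hω))
    fun _ ht => ⟨ht, mem_univ _⟩

variable [NormedSpace ℝ E] [NormedSpace ℝ W]

theorem exists_bound_near [FiniteDimensional ℝ E] [FiniteDimensional ℝ W] {a b : ℝ}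
    {h : ℝ × E × W → F} (hh : ContinuousOn h (Icc a b ×ˢ univ))
    {ξ : ℝ → E} {ω : ℝ → W} (hξ : ContinuousOn ξ (Icc a b)) (hω : ContinuousOn ω (Icc a b))
    (ρ : ℝ) :
    ∃ C, 0 ≤ C ∧ ∀ t ∈ Icc a b, ∀ z w, ‖z‖ ≤ ρ → ‖w‖ ≤ ρ →
      ‖h (t, ξ t + z, ω t + w)‖ ≤ C := by
  have := FiniteDimensional.proper ℝ E
  have := FiniteDimensional.proper ℝ W
  obtain ⟨C, hC⟩ := (isCompact_Icc.prod ((isCompact_closedBall (0 : E) ρ).prod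
    (isCompact_closedBall (0 : W) ρ))).exists_bound_of_continuousOn
      ((continuousOn_translate hh hξ hω).mono (prod_mono_right (subset_univ _)))
  refine ⟨max C 0, le_max_right _ _, fun t ht z w hz hw => (hC (t, z, w) ⟨ht, ?_, ?_⟩).trans
    (le_max_left _ _)⟩ <;> simpa

theorem exists_uniform_modulus [FiniteDimensional ℝ E] [FiniteDimensional ℝ W] {a b : ℝ}
    {h : ℝ × E × W → F} (hh : ContinuousOn h (Icc a b ×ˢ univ))
    {ξ : ℝ → E} {ω : ℝ → W} (hξ : ContinuousOn ξ (Icc a b)) (hω : ContinuousOn ω (Icc a b))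
    {ε : ℝ} (hε : 0 < ε) :
    ∃ δ, 0 < δ ∧ ∀ t ∈ Icc a b, ∀ z w, ‖z‖ ≤ δ → ‖w‖ ≤ δ →
      ‖h (t, ξ t + z, ω t + w) - h (t, ξ t, ω t)‖ ≤ ε := by
  have := FiniteDimensional.proper ℝ E
  have := FiniteDimensional.proper ℝ W
  have hu := (isCompact_Icc.prod ((isCompact_closedBall (0 : E) 1).prod
    (isCompact_closedBall (0 : W) 1))).uniformContinuousOn_of_continuous
      ((continuousOn_translate hh hξ hω).mono (prod_mono_right (subset_univ _)))
  obtain ⟨δ, hδ, H⟩ := Metric.uniformContinuousOn_iff.1 hu ε hε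
  have hmin : min (δ / 2) 1 < δ := (min_le_left _ _).trans_lt (half_lt_self hδ)
  refine ⟨min (δ / 2) 1, lt_min (half_pos hδ) one_pos, fun t ht z w hz hw => ?_⟩
  have := H (t, z, w) ⟨ht, by simpa using hz.trans (min_le_right _ _),
    by simpa using hw.trans (min_le_right _ _)⟩ (t, 0, 0) ⟨ht, by simp, by simp⟩ (by
      simp only [Prod.dist_eq, dist_self, dist_zero_right]
      exact max_lt hδ (max_lt (hz.trans_lt hmin) (hw.trans_lt hmin)))
  rw [dist_eq_norm] at this
  simpa using this.le

variable [NormedSpace ℝ F]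

/-- `gx` and `gw` are the partial derivatives of `g t y w` in `y` and `w` for times `t ∈ T`, and
they are jointly continuous. -/
structure HasPartials (T : Set ℝ) (g : ℝ → E → W → F) (gx : ℝ × E × W → E →L[ℝ] F)
    (gw : ℝ × E × W → W →L[ℝ] F) : Prop where
  continuousOn_left : ContinuousOn gx (T ×ˢ univ)
  continuousOn_right : ContinuousOn gw (T ×ˢ univ)
  hasFDerivAt_left : ∀ t ∈ T, ∀ y w, HasFDerivAt (fun y => g t y w) (gx (t, y, w)) y
  hasFDerivAt_right : ∀ t ∈ T, ∀ y w, HasFDerivAt (fun w => g t y w) (gw (t, y, w)) w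

/-- The mean value inequality, in each of the two variables in turn. -/
theorem HasPartials.norm_increment_sub_le {T : Set ℝ} {g : ℝ → E → W → F}
    {gx : ℝ × E × W → E →L[ℝ] F} {gw : ℝ × E × W → W →L[ℝ] F} (hg : HasPartials T g gx gw)
    {t : ℝ} (ht : t ∈ T) (y₀ : E) (w₀ : W) {φ : E →L[ℝ] F} {χ : W →L[ℝ] F} {r C : ℝ}
    (hφ : ∀ z w, ‖z‖ ≤ r → ‖w‖ ≤ r → ‖gx (t, y₀ + z, w₀ + w) - φ‖ ≤ C)
    (hχ : ∀ z w, ‖z‖ ≤ r → ‖w‖ ≤ r → ‖gw (t, y₀ + z, w₀ + w) - χ‖ ≤ C)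
    {z : E} {w : W} (hz : ‖z‖ ≤ r) (hw : ‖w‖ ≤ r) :
    ‖g t (y₀ + z) (w₀ + w) - g t y₀ w₀ - φ z - χ w‖ ≤ C * (‖z‖ + ‖w‖) := by
  have hr : 0 ≤ r := (norm_nonneg z).trans hz
  have h1 := Convex.norm_image_sub_le_of_norm_hasFDerivWithin_le' (𝕜 := ℝ)
    (s := Metric.closedBall y₀ r) (f := fun y => g t y (w₀ + w)) (φ := φ) (C := C)
    (f' := fun y => gx (t, y, w₀ + w)) (x := y₀) (y := y₀ + z)
    (fun y _ => (hg.hasFDerivAt_left t ht y (w₀ + w)).hasFDerivWithinAt)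
    (fun y hy => by
      have := hφ (y - y₀) w (by simpa [dist_eq_norm] using hy) hw
      rwa [add_sub_cancel] at this)
    (convex_closedBall _ _) (Metric.mem_closedBall_self hr) (by simpa using hz)
  have h2 := Convex.norm_image_sub_le_of_norm_hasFDerivWithin_le' (𝕜 := ℝ)
    (s := Metric.closedBall w₀ r) (f := fun w => g t y₀ w) (φ := χ) (C := C)
    (f' := fun w => gw (t, y₀, w)) (x := w₀) (y := w₀ + w)
    (fun w _ => (hg.hasFDerivAt_right t ht y₀ w).hasFDerivWithinAt)
    (fun w hw => by
      have := hχ 0 (w - w₀) (by simpa using hr) (by simpa [dist_eq_norm] using hw)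
      rwa [add_sub_cancel, add_zero] at this)
    (convex_closedBall _ _) (Metric.mem_closedBall_self hr) (by simpa using hw)
  simp only [add_sub_cancel_left] at h1 h2
  calc ‖g t (y₀ + z) (w₀ + w) - g t y₀ w₀ - φ z - χ w‖
      = ‖(g t (y₀ + z) (w₀ + w) - g t y₀ (w₀ + w) - φ z)
          + (g t y₀ (w₀ + w) - g t y₀ w₀ - χ w)‖ := by congr 1; abel
    _ ≤ _ := norm_add_le _ _
    _ ≤ C * ‖z‖ + C * ‖w‖ := add_le_add h1 h2
    _ = _ := by ring

theorem HasPartials.exists_linear_approximation [FiniteDimensional ℝ E] [FiniteDimensional ℝ W]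
    {a b : ℝ} {g : ℝ → E → W → F}
    {gx : ℝ × E × W → E →L[ℝ] F} {gw : ℝ × E × W → W →L[ℝ] F}
    (hg : HasPartials (Icc a b) g gx gw) {ξ : ℝ → E} {ω : ℝ → W}
    (hξ : ContinuousOn ξ (Icc a b)) (hω : ContinuousOn ω (Icc a b)) {ε : ℝ} (hε : 0 < ε) :
    ∃ δ, 0 < δ ∧ ∀ t ∈ Icc a b, ∀ z w, ‖z‖ ≤ δ → ‖w‖ ≤ δ →
      ‖g t (ξ t + z) (ω t + w) - g t (ξ t) (ω t) - gx (t, ξ t, ω t) z - gw (t, ξ t, ω t) w‖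
        ≤ ε * (‖z‖ + ‖w‖) := by
  obtain ⟨δ₁, hδ₁, H₁⟩ := exists_uniform_modulus hg.continuousOn_left hξ hω hε
  obtain ⟨δ₂, hδ₂, H₂⟩ := exists_uniform_modulus hg.continuousOn_right hξ hω hε
  refine ⟨min δ₁ δ₂, lt_min hδ₁ hδ₂, fun t ht z w hz hw => ?_⟩
  exact hg.norm_increment_sub_le ht (ξ t) (ω t)
    (fun z w hz hw => H₁ t ht z w (hz.trans (min_le_left _ _)) (hw.trans (min_le_left _ _)))
    (fun z w hz hw => H₂ t ht z w (hz.trans (min_le_right _ _)) (hw.trans (min_le_right _ _)))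
    hz hw

end Estimates

/-! ### Perturbation of a trajectory -/

section Trajectory

variable {m : ℕ} {W : Type*} [NormedAddCommGroup W] [NormedSpace ℝ W] [FiniteDimensional ℝ W]
  {a b : ℝ}

/-- If the control `ω` is perturbed to `ω + s • v` with `s > 0` small, then a state still exists on
the whole time interval, at a distance of order `s` from the unperturbed state. -/
theorem exists_perturbed_state (hab : a ≤ b)
    {f : ℝ → EuclideanSpace ℝ (Fin m) → W → EuclideanSpace ℝ (Fin m)}
    {fx : ℝ × EuclideanSpace ℝ (Fin m) × W →
      EuclideanSpace ℝ (Fin m) →L[ℝ] EuclideanSpace ℝ (Fin m)}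
    {fw : ℝ × EuclideanSpace ℝ (Fin m) × W → W →L[ℝ] EuclideanSpace ℝ (Fin m)}
    (hf : ContinuousOn (fun q : ℝ × EuclideanSpace ℝ (Fin m) × W => f q.1 q.2.1 q.2.2)
      (Icc a b ×ˢ univ))
    (hf' : HasPartials (Icc a b) f fx fw) {ξ : ℝ → EuclideanSpace ℝ (Fin m)} {ω v : ℝ → W}
    (hω : ContinuousOn ω (Icc a b)) (hv : ContinuousOn v (Icc a b))
    (hξ : ∀ t ∈ Icc a b, HasDerivWithinAt ξ (f t (ξ t) (ω t)) (Icc a b) t) :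
    ∃ C δ, 0 ≤ C ∧ 0 < δ ∧ ∀ s, 0 < s → s ≤ δ → ∃ y : ℝ → EuclideanSpace ℝ (Fin m),
      y a = ξ a ∧
      (∀ t ∈ Icc a b, HasDerivWithinAt y (f t (y t) (ω t + s • v t)) (Icc a b) t) ∧
      ∀ t ∈ Icc a b, ‖y t - ξ t‖ ≤ C * s := by
  have hξc : ContinuousOn ξ (Icc a b) := fun t ht => (hξ t ht).continuousWithinAt
  obtain ⟨V, hV⟩ := isCompact_Icc.exists_bound_of_continuousOn hv
  have hV0 : 0 ≤ V := (norm_nonneg _).trans (hV a (left_mem_Icc.2 hab))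
  have hm0 : 0 ≤ √(m : ℝ) := Real.sqrt_nonneg _
  obtain ⟨C₁, hC₁, H₁⟩ := exists_bound_near hf'.continuousOn_left hξc hω (√m * 1 + V)
  obtain ⟨C₂, hC₂, H₂⟩ := exists_bound_near hf'.continuousOn_right hξc hω (√m * 1 + V)
  -- The summand `1` makes the Grönwall constant nonzero, where `gronwallBound` is explicit.
  set K := C₁ + C₂ + 1 with hK
  have hKpos : 0 < K := by positivity
  set C := K * V / K * (Real.exp (K * (b - a)) - 1) with hC
  have hC0 : 0 ≤ C := by
    refine mul_nonneg (by positivity) (sub_nonneg.2 (Real.one_le_exp ?_))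
    exact mul_nonneg hKpos.le (sub_nonneg.2 hab)
  refine ⟨C, min 1 (C + 1)⁻¹, hC0, by positivity, fun s hs hsδ => ?_⟩
  have hs1 : s ≤ 1 := hsδ.trans (min_le_left _ _)
  have hsv : ∀ t ∈ Icc a b, ‖s • v t‖ ≤ V * s := fun t ht => by
    rw [norm_smul, Real.norm_of_nonneg hs.le, mul_comm]
    exact mul_le_mul_of_nonneg_right (hV t ht) hs.le
  have hsρ : ∀ t ∈ Icc a b, ‖s • v t‖ ≤ √m * 1 + V := fun t ht =>
    (hsv t ht).trans (by nlinarith)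
  have hF : ContinuousOn (Function.uncurry fun t y => f t y (ω t + s • v t))
      (Icc a b ×ˢ univ) := by
    have h1 : MapsTo Prod.fst (Icc a b ×ˢ (univ : Set (EuclideanSpace ℝ (Fin m)))) (Icc a b) :=
      fun q hq => hq.1
    refine hf.comp (f := fun q : ℝ × EuclideanSpace ℝ (Fin m) =>
      (q.1, q.2, ω q.1 + s • v q.1)) (continuousOn_fst.prodMk (continuousOn_snd.prodMk ?_))
      fun q hq => ⟨hq.1, mem_univ _⟩
    exact (hω.add (hv.const_smul s)).comp continuousOn_fst h1
  have hlip : ∀ t ∈ Icc a b, LipschitzOnWith C₁.toNNReal (fun y => f t y (ω t + s • v t))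
      (Metric.closedBall (ξ t) (√m * 1)) := by
    intro t ht
    refine Convex.lipschitzOnWith_of_nnnorm_hasFDerivWithin_le (𝕜 := ℝ)
      (f' := fun y => fx (t, y, ω t + s • v t))
      (fun y _ => (hf'.hasFDerivAt_left t ht y _).hasFDerivWithinAt) (fun y hy => ?_)
      (convex_closedBall _ _)
    rw [← NNReal.coe_le_coe, coe_nnnorm, Real.coe_toNNReal _ hC₁]
    have := H₁ t ht (y - ξ t) (s • v t) ?_ (hsρ t ht)
    · rwa [add_sub_cancel] at this
    · rw [Metric.mem_closedBall, dist_eq_norm] at hy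
      linarith
  obtain ⟨y, hya, hy⟩ := exists_truncated_solution hab hF hξc zero_le_one hlip (ξ a)
  have hbound : ∀ t ∈ Icc a b, ‖y t - ξ t‖ ≤ C * s := by
    have := norm_le_gronwallBound le_rfl hKpos.le (ε := K * V * s) (by positivity)
      (y := fun t => y t - ξ t) (fun t ht => (hy t ht).sub (hξ t ht)) (by simp [hya]) ?_
    · intro t ht
      refine (this t ht).trans_eq ?_
      rw [gronwallBound_of_K_ne_0 hKpos.ne', hC]
      ring
    · intro t ht
      have h1 := hf'.norm_increment_sub_le (r := √m * 1 + V) (C := K) ht (ξ t) (ω t)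
        (φ := 0) (χ := 0) (z := clamp 1 (y t - ξ t)) (w := s • v t)
        (fun z w hz hw => by
          rw [sub_zero]
          exact (H₁ t ht z w hz hw).trans (by linarith))
        (fun z w hz hw => by
          rw [sub_zero]
          exact (H₂ t ht z w hz hw).trans (by linarith))
        ((norm_clamp_le_radius zero_le_one _).trans (by linarith)) (hsρ t ht)
      simp only [zero_apply, sub_zero] at h1
      refine h1.trans ?_
      have h2 := mul_le_mul_of_nonneg_left
        (add_le_add (norm_clamp_le zero_le_one (y t - ξ t)) (hsv t ht)) hKpos.le
      linarith
  refine ⟨y, hya, fun t ht => ?_, hbound⟩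
  -- The perturbed trajectory stays so close to `ξ` that the truncation has no effect.
  have h1 : ‖y t - ξ t‖ ≤ 1 := by
    refine (hbound t ht).trans ?_
    have h2 : C * s ≤ C * (C + 1)⁻¹ :=
      mul_le_mul_of_nonneg_left (hsδ.trans (min_le_right _ _)) hC0
    refine h2.trans ?_
    rw [← div_eq_mul_inv, div_le_one (by positivity)]
    linarith
  have h3 := hy t ht
  rwa [clamp_of_norm_le h1, add_sub_cancel] at h3

/-- The first variation of the functional `Ψ (y b) + ∫ l (t, y, w) dt` in the direction `v`,
expressed through the adjoint trajectory `p`. Pairing the adjoint equation with the displacement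
`y - ξ` and integrating makes the terms of first order in the displacement cancel, so that the
linearized state equation need not be solved. -/
theorem exists_first_variation_bound (hab : a ≤ b)
    {f : ℝ → EuclideanSpace ℝ (Fin m) → W → EuclideanSpace ℝ (Fin m)}
    {fx : ℝ × EuclideanSpace ℝ (Fin m) × W →
      EuclideanSpace ℝ (Fin m) →L[ℝ] EuclideanSpace ℝ (Fin m)}
    {fw : ℝ × EuclideanSpace ℝ (Fin m) × W → W →L[ℝ] EuclideanSpace ℝ (Fin m)}
    (hf : ContinuousOn (fun q : ℝ × EuclideanSpace ℝ (Fin m) × W => f q.1 q.2.1 q.2.2)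
      (Icc a b ×ˢ univ))
    (hf' : HasPartials (Icc a b) f fx fw)
    {l : ℝ → EuclideanSpace ℝ (Fin m) → W → ℝ}
    {lx : ℝ × EuclideanSpace ℝ (Fin m) × W → EuclideanSpace ℝ (Fin m) →L[ℝ] ℝ}
    {lw : ℝ × EuclideanSpace ℝ (Fin m) × W → W →L[ℝ] ℝ} (hl' : HasPartials (Icc a b) l lx lw)
    {ξ : ℝ → EuclideanSpace ℝ (Fin m)} {ω v : ℝ → W}
    (hω : ContinuousOn ω (Icc a b)) (hv : ContinuousOn v (Icc a b))
    (hξ : ∀ t ∈ Icc a b, HasDerivWithinAt ξ (f t (ξ t) (ω t)) (Icc a b) t)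
    (hlξ : IntervalIntegrable (fun t => l t (ξ t) (ω t)) volume a b)
    {Ψ : EuclideanSpace ℝ (Fin m) → ℝ} {Ψ' : EuclideanSpace ℝ (Fin m) →L[ℝ] ℝ}
    (hΨ : HasFDerivAt Ψ Ψ' (ξ b)) {p p' : ℝ → EuclideanSpace ℝ (Fin m)}
    (hp : ∀ t ∈ Icc a b, HasDerivWithinAt p (p' t) (Icc a b) t)
    (hp'c : ContinuousOn p' (Icc a b))
    (hp' : ∀ t ∈ Icc a b, ∀ z, inner ℝ (p' t) z =
      -(inner ℝ (p t) (fx (t, ξ t, ω t) z)) - lx (t, ξ t, ω t) z)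
    (hpb : ∀ z, inner ℝ (p b) z = Ψ' z) {C : ℝ} (hC : 0 ≤ C) {ε : ℝ} (hε : 0 < ε) :
    ∃ δ, 0 < δ ∧ ∀ s, 0 < s → s ≤ δ → ∀ y : ℝ → EuclideanSpace ℝ (Fin m), y a = ξ a →
      (∀ t ∈ Icc a b, HasDerivWithinAt y (f t (y t) (ω t + s • v t)) (Icc a b) t) →
      (∀ t ∈ Icc a b, ‖y t - ξ t‖ ≤ C * s) →
      IntervalIntegrable (fun t => l t (y t) (ω t + s • v t)) volume a b →
      |(Ψ (y b) + ∫ t in a..b, l t (y t) (ω t + s • v t))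
        - (Ψ (ξ b) + ∫ t in a..b, l t (ξ t) (ω t))
        - s * ∫ t in a..b, (lw (t, ξ t, ω t) (v t)
          + inner ℝ (p t) (fw (t, ξ t, ω t) (v t)))| ≤ ε * s := by
  have hξc : ContinuousOn ξ (Icc a b) := fun t ht => (hξ t ht).continuousWithinAt
  have hpc : ContinuousOn p (Icc a b) := fun t ht => (hp t ht).continuousWithinAt
  obtain ⟨V, hV⟩ := isCompact_Icc.exists_bound_of_continuousOn hv
  have hV0 : 0 ≤ V := (norm_nonneg _).trans (hV a (left_mem_Icc.2 hab))
  obtain ⟨M, hM⟩ := isCompact_Icc.exists_bound_of_continuousOn hpc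
  have hM0 : 0 ≤ M := (norm_nonneg _).trans (hM a (left_mem_Icc.2 hab))
  have hba : 0 ≤ b - a := sub_nonneg.2 hab
  set N := (b - a) * ((M + 1) * (C + V)) + C + 1 with hN
  have hNpos : 0 < N := by positivity
  -- With relative error `ε'`, the terminal term contributes `ε' * C * s` and the integral
  -- `(b - a) * (M + 1) * ε' * (C + V) * s`.
  set ε' := ε / N with hε'
  have hε'pos : 0 < ε' := div_pos hε hNpos
  obtain ⟨δ₁, hδ₁, H₁⟩ := hf'.exists_linear_approximation hξc hω hε'pos
  obtain ⟨δ₂, hδ₂, H₂⟩ := hl'.exists_linear_approximation hξc hω hε'pos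
  obtain ⟨δ₃, hδ₃, H₃⟩ := Metric.eventually_nhds_iff.1 (hΨ.isLittleO.def hε'pos)
  refine ⟨min δ₁ (min δ₂ (δ₃ / 2)) / (C + V + 1), by positivity,
    fun s hs hsδ y hya hy hyC hly => ?_⟩
  have hsδ' : (C + V + 1) * s ≤ min δ₁ (min δ₂ (δ₃ / 2)) := by
    rw [le_div_iff₀ (by positivity)] at hsδ
    linarith
  have hsδ₁ : (C + V + 1) * s ≤ δ₁ := hsδ'.trans (min_le_left _ _)
  have hsδ₂ : (C + V + 1) * s ≤ δ₂ := hsδ'.trans ((min_le_right _ _).trans (min_le_left _ _))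
  have hsδ₃ : (C + V + 1) * s ≤ δ₃ / 2 :=
    hsδ'.trans ((min_le_right _ _).trans (min_le_right _ _))
  have hCs : 0 ≤ C * s := by positivity
  have hVs : 0 ≤ V * s := by positivity
  have hCs1 : C * s ≤ (C + V + 1) * s := by nlinarith
  have hVs1 : V * s ≤ (C + V + 1) * s := by nlinarith
  have hsv : ∀ t ∈ Icc a b, ‖s • v t‖ ≤ V * s := fun t ht => by
    rw [norm_smul, Real.norm_of_nonneg hs.le, mul_comm]
    exact mul_le_mul_of_nonneg_right (hV t ht) hs.le
  have hyc : ContinuousOn y (Icc a b) := fun t ht => (hy t ht).continuousWithinAt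
  have hωs : ContinuousOn (fun t => ω t + s • v t) (Icc a b) := hω.add (hv.const_smul s)
  set D : ℝ → EuclideanSpace ℝ (Fin m) :=
    fun t => f t (y t) (ω t + s • v t) - f t (ξ t) (ω t) with hD
  have hDc : ContinuousOn D (Icc a b) :=
    (continuousOn_along hf hyc hωs).sub (continuousOn_along hf hξc hω)
  have hDd : ∀ t ∈ Icc a b, HasDerivWithinAt (fun t => y t - ξ t) (D t) (Icc a b) t :=
    fun t ht => (hy t ht).sub (hξ t ht)
  set h' : ℝ → ℝ := fun t => inner ℝ (p t) (D t) + inner ℝ (p' t) (y t - ξ t) with hh'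
  have hh'c : ContinuousOn h' (Icc a b) :=
    (hpc.inner hDc).add (hp'c.inner (hyc.sub hξc))
  have hh'i : IntervalIntegrable h' volume a b := hh'c.intervalIntegrable_of_Icc hab
  have hparts : ∫ t in a..b, h' t = Ψ' (y b - ξ b) := by
    rw [intervalIntegral.integral_eq_sub_of_hasDeriv_right_of_le hab
      (f := fun t => inner ℝ (p t) (y t - ξ t)) (hpc.inner (hyc.sub hξc)) ?_ hh'i]
    · simp [hya, hpb]
    · intro t ht
      have ht' := Ioo_subset_Icc_self ht
      refine (((hp t ht').inner ℝ (hDd t ht')).hasDerivAt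
        (Icc_mem_nhds ht.1 ht.2)).hasDerivWithinAt
  set κ : ℝ → ℝ := fun t => lw (t, ξ t, ω t) (v t) + inner ℝ (p t) (fw (t, ξ t, ω t) (v t))
    with hκ
  have hκc : ContinuousOn κ (Icc a b) :=
    ((continuousOn_along hl'.continuousOn_right hξc hω).clm_apply hv).add
      (hpc.inner ((continuousOn_along hf'.continuousOn_right hξc hω).clm_apply hv))
  have hκi : IntervalIntegrable κ volume a b := hκc.intervalIntegrable_of_Icc hab
  set J := fun t => h' t + l t (y t) (ω t + s • v t) - l t (ξ t) (ω t) - s * κ t with hJ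
  have hJb : ∀ t ∈ uIoc a b, ‖J t‖ ≤ (M + 1) * (ε' * ((C + V) * s)) := by
    intro t ht
    rw [uIoc_of_le hab] at ht
    replace ht := Ioc_subset_Icc_self ht
    have hsum : ‖y t - ξ t‖ + ‖s • v t‖ ≤ (C + V) * s := by
      linarith [hyC t ht, hsv t ht]
    have e1 := H₁ t ht (y t - ξ t) (s • v t) ((hyC t ht).trans (by linarith))
      ((hsv t ht).trans (by linarith))
    have e2 := H₂ t ht (y t - ξ t) (s • v t) ((hyC t ht).trans (by linarith))
      ((hsv t ht).trans (by linarith))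
    rw [add_sub_cancel] at e1 e2
    have e3 := mul_le_mul_of_nonneg_left hsum hε'pos.le
    have hJt : J t = inner ℝ (p t) (f t (y t) (ω t + s • v t) - f t (ξ t) (ω t)
          - fx (t, ξ t, ω t) (y t - ξ t) - fw (t, ξ t, ω t) (s • v t))
        + (l t (y t) (ω t + s • v t) - l t (ξ t) (ω t)
          - lx (t, ξ t, ω t) (y t - ξ t) - lw (t, ξ t, ω t) (s • v t)) := by
      simp only [hJ, hh', hκ, hD, hp' t ht]
      simp only [inner_sub_right, map_smul, inner_smul_right, smul_eq_mul]
      ring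
    rw [hJt]
    calc _ ≤ _ := norm_add_le _ _
      _ ≤ M * (ε' * ((C + V) * s)) + ε' * ((C + V) * s) := by
        refine add_le_add ((norm_inner_le_norm _ _).trans ?_) (e2.trans e3)
        exact mul_le_mul (hM t ht) (e1.trans e3) (norm_nonneg _) hM0
      _ = _ := by ring
  have hJi := intervalIntegral.norm_integral_le_of_norm_le_const hJb
  rw [abs_of_nonneg hba, Real.norm_eq_abs] at hJi
  have hJe : ∫ t in a..b, J t = Ψ' (y b - ξ b) + (∫ t in a..b, l t (y t) (ω t + s • v t))
      - (∫ t in a..b, l t (ξ t) (ω t)) - s * ∫ t in a..b, κ t := by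
    rw [hJ, intervalIntegral.integral_sub ((hh'i.add hly).sub hlξ) (hκi.const_mul s),
      intervalIntegral.integral_sub (hh'i.add hly) hlξ, intervalIntegral.integral_add hh'i hly,
      intervalIntegral.integral_const_mul, hparts]
  have hbmem : b ∈ Icc a b := right_mem_Icc.2 hab
  have e4 : |Ψ (y b) - Ψ (ξ b) - Ψ' (y b - ξ b)| ≤ ε' * (C * s) := by
    have := H₃ (y := y b) (by
      rw [dist_eq_norm]
      exact (hyC b hbmem).trans_lt (by linarith))
    rw [Real.norm_eq_abs] at this
    exact this.trans (mul_le_mul_of_nonneg_left (hyC b hbmem) hε'pos.le)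
  calc _ = |(Ψ (y b) - Ψ (ξ b) - Ψ' (y b - ξ b)) + ∫ t in a..b, J t| := by
        rw [hJe]; congr 1; ring
    _ ≤ _ := abs_add_le _ _
    _ ≤ ε' * (C * s) + (M + 1) * (ε' * ((C + V) * s)) * (b - a) := add_le_add e4 hJi
    _ = ε' * (N - 1) * s := by rw [hN]; ring
    _ ≤ ε' * N * s := by
        have : 0 ≤ ε' * s := by positivity
        nlinarith
    _ = ε * s := by rw [hε', div_mul_cancel₀ _ hNpos.ne']

end Trajectory

/-! ### The generalized Hukuhara derivative of an end-point differentiable function -/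

/-- The compact interval spanned by two real numbers, in either order. -/
def hull (α β : ℝ) : NonemptyInterval ℝ :=
  ⟨(min α β, max α β), min_le_max⟩

theorem convexCombination_mem_hull {c : ℝ} (h0 : 0 ≤ c) (h1 : c ≤ 1) (α β : ℝ) :
    c * α + (1 - c) * β ∈ hull α β := by
  rw [NonemptyInterval.mem_def]
  change min α β ≤ _ ∧ _ ≤ max α β
  constructor
  · nlinarith [min_le_left α β, min_le_right α β]
  · nlinarith [le_max_left α β, le_max_right α β]

theorem neg_mem_neg_iff {r : ℝ} {A : NonemptyInterval ℝ} : -r ∈ -A ↔ r ∈ A := by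
  simp only [NonemptyInterval.mem_def, NonemptyInterval.fst_neg, NonemptyInterval.snd_neg,
    neg_le_neg_iff]
  exact and_comm

theorem scale_gHSub (c : ℝ) (A B : NonemptyInterval ℝ) :
    scale c (gHSub A B) = hull (c * (A.fst - B.fst)) (c * (A.snd - B.snd)) := by
  have h : ∀ x y : ℝ, min (c * min x y) (c * max x y) = min (c * x) (c * y) ∧
      max (c * min x y) (c * max x y) = max (c * x) (c * y) := fun x y => by
    rcases le_total x y with h | h
    · simp [h]
    · simp [h, min_comm, max_comm]
  ext
  · exact (h _ _).1
  · exact (h _ _).2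

theorem hasGHDerivAt_of_hasDerivAt {F : ℝ → NonemptyInterval ℝ} {α β s : ℝ}
    (hα : HasDerivAt (fun r => (F r).fst) α s) (hβ : HasDerivAt (fun r => (F r).snd) β s) :
    HasGHDerivAt F (hull α β) s := by
  rw [hasDerivAt_iff_tendsto_slope_zero] at hα hβ
  simp only [HasGHDerivAt, IntervalTendsto, scale_gHSub]
  exact ⟨hα.min hβ, hα.max hβ⟩

theorem hasGHGradientAt_of_hasFDerivAt {k : ℕ}
    {F : EuclideanSpace ℝ (Fin k) → NonemptyInterval ℝ} {φ χ : EuclideanSpace ℝ (Fin k) →L[ℝ] ℝ}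
    {y : EuclideanSpace ℝ (Fin k)} (hφ : HasFDerivAt (fun z => (F z).fst) φ y)
    (hχ : HasFDerivAt (fun z => (F z).snd) χ y) :
    HasGHGradientAt F
      (fun j => hull (φ (EuclideanSpace.single j 1)) (χ (EuclideanSpace.single j 1))) y := by
  intro j
  have hline : ∀ s : ℝ, WithLp.toLp 2 (Function.update y.ofLp j s)
      = y + (s - y j) • EuclideanSpace.single j (1 : ℝ) := by
    intro s
    ext r
    by_cases h : r = j
    · subst h; simp
    · simp [h]
  have hd : HasDerivAt (fun s : ℝ => WithLp.toLp 2 (Function.update y.ofLp j s))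
      (EuclideanSpace.single j (1 : ℝ)) (y j) := by
    simp only [hline]
    simpa using (((hasDerivAt_id (y j)).sub_const (y j)).smul_const
      (EuclideanSpace.single j (1 : ℝ))).const_add y
  have hy : WithLp.toLp 2 (Function.update y.ofLp j (y j)) = y := by simp
  exact hasGHDerivAt_of_hasDerivAt
    (HasFDerivAt.comp_hasDerivAt (l := fun z => (F z).fst) (y j) (by rwa [hy]) hd)
    (HasFDerivAt.comp_hasDerivAt (l := fun z => (F z).snd) (y j) (by rwa [hy]) hd)

/-! ### End-points of the Aumann integral and of the payoffs -/

theorem isLeast_aumannIntegral {F : ℝ → NonemptyInterval ℝ} {a b : ℝ} (hab : a ≤ b)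
    (hF : IntervalIntegrable (fun t => (F t).fst) volume a b) :
    IsLeast (aumannIntegral F a b) (∫ t in a..b, (F t).fst) := by
  refine ⟨⟨_, hF, ae_of_all _ fun t => ⟨le_rfl, (F t).fst_le_snd⟩, rfl⟩, ?_⟩
  rintro _ ⟨g, hg, hgF, rfl⟩
  refine intervalIntegral.integral_mono_ae_restrict hab hF hg ?_
  filter_upwards [hgF] with t ht using ht.1

theorem isGreatest_aumannIntegral {F : ℝ → NonemptyInterval ℝ} {a b : ℝ} (hab : a ≤ b)
    (hF : IntervalIntegrable (fun t => (F t).snd) volume a b) :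
    IsGreatest (aumannIntegral F a b) (∫ t in a..b, (F t).snd) := by
  refine ⟨⟨_, hF, ae_of_all _ fun t => ⟨(F t).fst_le_snd, le_rfl⟩, rfl⟩, ?_⟩
  rintro _ ⟨g, hg, hgF, rfl⟩
  refine intervalIntegral.integral_mono_ae_restrict hab hg hF ?_
  filter_upwards [hgF] with t ht using ht.2

namespace Game

variable {n m : ℕ} {d : Fin n → ℕ}

theorem lowerPayoff_eq (G : Game n m d) (i : Fin n) (u : G.Profile)
    (x : ℝ → EuclideanSpace ℝ (Fin m))
    (hL : IntervalIntegrable (fun t => (G.L i t (x t) (G.value u t)).fst) volume G.t₀ G.t₁) :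
    G.lowerPayoff i u x = (G.ψ i (x G.t₁)).fst
      + ∫ t in G.t₀..G.t₁, (G.L i t (x t) (G.value u t)).fst := by
  have h := isLeast_aumannIntegral G.t₀_lt_t₁.le hL
  refine IsLeast.csInf_eq ⟨add_mem_add ⟨le_rfl, (G.ψ i (x G.t₁)).fst_le_snd⟩ h.1, ?_⟩
  rintro _ ⟨r, hr, q, hq, rfl⟩
  exact add_le_add hr.1 (h.2 hq)

theorem upperPayoff_eq (G : Game n m d) (i : Fin n) (u : G.Profile)
    (x : ℝ → EuclideanSpace ℝ (Fin m))
    (hL : IntervalIntegrable (fun t => (G.L i t (x t) (G.value u t)).snd) volume G.t₀ G.t₁) :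
    G.upperPayoff i u x = (G.ψ i (x G.t₁)).snd
      + ∫ t in G.t₀..G.t₁, (G.L i t (x t) (G.value u t)).snd := by
  have h := isGreatest_aumannIntegral G.t₀_lt_t₁.le hL
  refine IsGreatest.csSup_eq ⟨add_mem_add ⟨(G.ψ i (x G.t₁)).fst_le_snd, le_rfl⟩ h.1, ?_⟩
  rintro _ ⟨r, hr, q, hq, rfl⟩
  exact add_le_add hr.2 (h.2 hq)

theorem continuous_value (G : Game n m d) (u : G.Profile) : Continuous (G.value u) :=
  continuous_pi fun k => (u k).continuous.comp continuous_projIcc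

theorem value_update (G : Game n m d) (u : G.Profile) (i : Fin n)
    (w : C(Icc G.t₀ G.t₁, EuclideanSpace ℝ (Fin (d i)))) (t : ℝ) :
    G.value (Function.update u i w) t
      = Function.update (G.value u t) i (w (projIcc G.t₀ G.t₁ G.t₀_lt_t₁.le t)) := by
  ext1 k
  by_cases h : k = i
  · subst h; simp [value]
  · simp [value, h]

end Game

theorem continuousOn_comp_update {n : ℕ} {d : Fin n → ℕ} {E F : Type*} [TopologicalSpace E]
    [TopologicalSpace F] {T : Set ℝ} {h : ℝ × E × Controls d → F}
    (hh : ContinuousOn h (T ×ˢ univ)) {U : ℝ → Controls d} (hU : Continuous U) (i : Fin n) :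
    ContinuousOn (fun q : ℝ × E × EuclideanSpace ℝ (Fin (d i)) =>
      h (q.1, q.2.1, Function.update (U q.1) i q.2.2)) (T ×ˢ univ) :=
  hh.comp (f := fun q : ℝ × E × EuclideanSpace ℝ (Fin (d i)) =>
      (q.1, q.2.1, Function.update (U q.1) i q.2.2))
    (Continuous.continuousOn (continuous_fst.prodMk ((continuous_fst.comp continuous_snd).prodMk
      ((hU.comp continuous_fst).update i (continuous_snd.comp continuous_snd)))))
    fun _ hq => ⟨hq.1, mem_univ _⟩

/-- With the controls of the other players frozen along a continuous curve, only the partial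
derivatives in the state and in the control of one player remain. -/
theorem HasContinuousPartials.exists_hasPartials {n m : ℕ} {d : Fin n → ℕ} {F : Type*}
    [NormedAddCommGroup F] [NormedSpace ℝ F] {T : Set ℝ}
    {g : ℝ → EuclideanSpace ℝ (Fin m) → Controls d → F} (hg : HasContinuousPartials T g)
    {U : ℝ → Controls d} (hU : Continuous U) (i : Fin n) :
    ∃ gx gw, HasPartials T (fun t y w => g t y (Function.update (U t) i w)) gx gw := by
  obtain ⟨⟨gx, hgx, hx⟩, hk⟩ := hg
  obtain ⟨gw, hgw, hw⟩ := hk i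
  exact ⟨_, _,
    { continuousOn_left := continuousOn_comp_update hgx hU i
      continuousOn_right := continuousOn_comp_update hgw hU i
      hasFDerivAt_left := fun t ht y w => hx t ht y _
      hasFDerivAt_right := fun t ht y w => by
        simpa using hw t ht y (Function.update (U t) i w) }⟩

/-! ### The adjoint equation -/

/-- The terminal value problem `p' = -Aᵀ p - c`, `p b = Ψ'` for the adjoint trajectory, in weak
form: covectors are represented by the inner product. -/
theorem exists_adjoint_trajectory {m : ℕ} {a b : ℝ} (hab : a ≤ b)
    {A : ℝ → EuclideanSpace ℝ (Fin m) →L[ℝ] EuclideanSpace ℝ (Fin m)}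
    {c : ℝ → EuclideanSpace ℝ (Fin m) →L[ℝ] ℝ}
    (hA : ContinuousOn A (Icc a b)) (hc : ContinuousOn c (Icc a b))
    (Ψ' : EuclideanSpace ℝ (Fin m) →L[ℝ] ℝ) :
    ∃ p p' : ℝ → EuclideanSpace ℝ (Fin m),
      (∀ t ∈ Icc a b, HasDerivWithinAt p (p' t) (Icc a b) t) ∧ ContinuousOn p' (Icc a b) ∧
      (∀ t ∈ Icc a b, ∀ z, inner ℝ (p' t) z = -(inner ℝ (p t) (A t z)) - c t z) ∧
      ∀ z, inner ℝ (p b) z = Ψ' z := by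
  have hA' : ContinuousOn (fun t => -(ContinuousLinearMap.adjoint (A t))) (Icc a b) :=
    (ContinuousLinearMap.adjoint.continuous.comp_continuousOn hA).neg
  have hc' : ContinuousOn
      (fun t => -((InnerProductSpace.toDual ℝ (EuclideanSpace ℝ (Fin m))).symm (c t)))
      (Icc a b) :=
    ((LinearIsometryEquiv.continuous _).comp_continuousOn hc).neg
  obtain ⟨p, hpb, hp⟩ := exists_linear_solution_terminal hab hA' hc'
    ((InnerProductSpace.toDual ℝ (EuclideanSpace ℝ (Fin m))).symm Ψ')
  have hpc : ContinuousOn p (Icc a b) := fun t ht => (hp t ht).continuousWithinAt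
  refine ⟨p, _, hp, (hA'.clm_apply hpc).add hc', fun t ht z => ?_, fun z => ?_⟩
  · simp [inner_add_left, ContinuousLinearMap.adjoint_inner_left, sub_eq_add_neg]
  · simp [hpb]

/-! ### The pairing of continuous functions -/

section Pairing

variable {W : Type*} [NormedAddCommGroup W] [InnerProductSpace ℝ W] {a b : ℝ}

/-- The functional `v ↦ ∫ ⟪g t, v t⟫ dt` on `C([a, b]; W)` represented by a continuous
function `g`. -/
noncomputable def pairing (hab : a ≤ b) (g : C(Icc a b, W)) : C(Icc a b, W) →ₗ[ℝ] ℝ where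
  toFun v := ∫ t in a..b, inner ℝ (g (projIcc a b hab t)) (v (projIcc a b hab t))
  map_add' v w := by
    simp only [ContinuousMap.add_apply, inner_add_right]
    refine intervalIntegral.integral_add ?_ ?_ <;>
    exact Continuous.intervalIntegrable ((g.continuous.comp continuous_projIcc).inner
      ((ContinuousMap.continuous _).comp continuous_projIcc)) _ _
  map_smul' r v := by
    simp only [ContinuousMap.smul_apply, inner_smul_right, RingHom.id_apply, smul_eq_mul]
    exact intervalIntegral.integral_const_mul _ _

theorem pairing_apply (hab : a ≤ b) (g v : C(Icc a b, W)) :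
    pairing hab g v = ∫ t in a..b, inner ℝ (g (projIcc a b hab t)) (v (projIcc a b hab t)) :=
  rfl

theorem continuous_pairing (hab : a ≤ b) (g : C(Icc a b, W)) : Continuous (pairing hab g) := by
  refine intervalIntegral.continuous_parametric_intervalIntegral_of_continuous'
    (f := fun (v : C(Icc a b, W)) t => inner ℝ (g (projIcc a b hab t)) (v (projIcc a b hab t)))
    ?_ a b
  have hp : Continuous fun q : C(Icc a b, W) × ℝ => projIcc a b hab q.2 :=
    continuous_projIcc.comp continuous_snd
  exact (g.continuous.comp hp).inner (continuous_eval.comp (continuous_fst.prodMk hp))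

theorem pairing_comm (hab : a ≤ b) (g v : C(Icc a b, W)) : pairing hab g v = pairing hab v g := by
  simp only [pairing_apply, real_inner_comm]

theorem eq_zero_of_pairing_self (hab : a < b) {g : C(Icc a b, W)}
    (hg : pairing hab.le g g = 0) : g = 0 := by
  ext t
  by_contra ht
  refine (intervalIntegral.integral_pos hab (Continuous.continuousOn
    ((g.continuous.comp continuous_projIcc).inner (g.continuous.comp continuous_projIcc)))
    (fun s _ => real_inner_self_nonneg) ⟨t, t.2, ?_⟩).ne' hg
  simpa using pow_pos (norm_pos_iff.2 ht) 2

end Pairing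

/-! ### The necessary conditions for one player -/

/-- The gradient of the Hamiltonian in the control, `lwᵀ + fwᵀ p`, as a vector of the control
space. -/
noncomputable def controlGradient {E W : Type*} [NormedAddCommGroup E] [InnerProductSpace ℝ E]
    [CompleteSpace E] [NormedAddCommGroup W] [InnerProductSpace ℝ W] [CompleteSpace W]
    (lw : W →L[ℝ] ℝ) (fw : W →L[ℝ] E) (p : E) : W :=
  (InnerProductSpace.toDual ℝ W).symm lw + ContinuousLinearMap.adjoint fw p

theorem inner_controlGradient {E W : Type*} [NormedAddCommGroup E] [InnerProductSpace ℝ E]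
    [CompleteSpace E] [NormedAddCommGroup W] [InnerProductSpace ℝ W] [CompleteSpace W]
    (lw : W →L[ℝ] ℝ) (fw : W →L[ℝ] E) (p : E) (v : W) :
    inner ℝ (controlGradient lw fw p) v = lw v + inner ℝ p (fw v) := by
  rw [controlGradient, inner_add_left, InnerProductSpace.toDual_symm_apply,
    ContinuousLinearMap.adjoint_inner_left]

theorem continuousOn_controlGradient {E W : Type*} [NormedAddCommGroup E]
    [InnerProductSpace ℝ E] [CompleteSpace E] [NormedAddCommGroup W] [InnerProductSpace ℝ W]
    [CompleteSpace W] {T : Set ℝ} {lw : ℝ → W →L[ℝ] ℝ} {fw : ℝ → W →L[ℝ] E} {p : ℝ → E}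
    (hl : ContinuousOn lw T) (hf : ContinuousOn fw T) (hp : ContinuousOn p T) :
    ContinuousOn (fun t => controlGradient (lw t) (fw t) (p t)) T :=
  ((LinearIsometryEquiv.continuous _).comp_continuousOn hl).add
    ((ContinuousLinearMap.adjoint.continuous.comp_continuousOn hf).clm_apply hp)

namespace Game

variable {n m : ℕ} {d : Fin n → ℕ}

theorem hasFDerivAt_hamiltonian_fst {k : ℕ} (G : Game n m d) (i : Fin n) (t : ℝ)
    (p : EuclideanSpace ℝ (Fin m)) {y : EuclideanSpace ℝ (Fin k) → EuclideanSpace ℝ (Fin m)}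
    {w : EuclideanSpace ℝ (Fin k) → Controls d} {z : EuclideanSpace ℝ (Fin k)}
    {φ : EuclideanSpace ℝ (Fin k) →L[ℝ] ℝ}
    {A : EuclideanSpace ℝ (Fin k) →L[ℝ] EuclideanSpace ℝ (Fin m)}
    (hφ : HasFDerivAt (fun z => (G.L i t (y z) (w z)).fst) φ z)
    (hA : HasFDerivAt (fun z => G.f t (y z) (w z)) A z) :
    HasFDerivAt (fun z => (G.hamiltonian i t (y z) (w z) p).fst)
      (φ + (innerSL ℝ p).comp A) z :=
  hφ.add ((innerSL ℝ p).hasFDerivAt.comp z hA)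

theorem hasFDerivAt_hamiltonian_snd {k : ℕ} (G : Game n m d) (i : Fin n) (t : ℝ)
    (p : EuclideanSpace ℝ (Fin m)) {y : EuclideanSpace ℝ (Fin k) → EuclideanSpace ℝ (Fin m)}
    {w : EuclideanSpace ℝ (Fin k) → Controls d} {z : EuclideanSpace ℝ (Fin k)}
    {χ : EuclideanSpace ℝ (Fin k) →L[ℝ] ℝ}
    {A : EuclideanSpace ℝ (Fin k) →L[ℝ] EuclideanSpace ℝ (Fin m)}
    (hχ : HasFDerivAt (fun z => (G.L i t (y z) (w z)).snd) χ z)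
    (hA : HasFDerivAt (fun z => G.f t (y z) (w z)) A z) :
    HasFDerivAt (fun z => (G.hamiltonian i t (y z) (w z) p).snd)
      (χ + (innerSL ℝ p).comp A) z :=
  hχ.add ((innerSL ℝ p).hasFDerivAt.comp z hA)

/-- At an equilibrium no direction `v`, feasible or not, raises both end-points of the payoff to
first order: the set of such directions is open, so it would contain a feasible one. The first
variations are represented by the functions `g₁` and `g₂`. -/
theorem not_both_pairings_pos (G : Game n m d) (i : Fin n) {u : G.Profile}
    {x : ℝ → EuclideanSpace ℝ (Fin m)} (heq : G.IsParetoNash u x)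
    (hu : G.ControlUnconstrainedAt i (u i)) (hint : G.PayoffsIntegrable)
    (hf : ContinuousOn
      (fun z : ℝ × EuclideanSpace ℝ (Fin m) × Controls d => G.f z.1 z.2.1 z.2.2)
      (Icc G.t₀ G.t₁ ×ˢ univ))
    {fx fw} (hf' : HasPartials (Icc G.t₀ G.t₁)
      (fun t y w => G.f t y (Function.update (G.value u t) i w)) fx fw)
    {l₁x l₁w} (hl₁ : HasPartials (Icc G.t₀ G.t₁)
      (fun t y w => (G.L i t y (Function.update (G.value u t) i w)).fst) l₁x l₁w)
    {l₂x l₂w} (hl₂ : HasPartials (Icc G.t₀ G.t₁)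
      (fun t y w => (G.L i t y (Function.update (G.value u t) i w)).snd) l₂x l₂w)
    {Ψ₁ Ψ₂ : EuclideanSpace ℝ (Fin m) →L[ℝ] ℝ}
    (hΨ₁ : HasFDerivAt (fun y => (G.ψ i y).fst) Ψ₁ (x G.t₁))
    (hΨ₂ : HasFDerivAt (fun y => (G.ψ i y).snd) Ψ₂ (x G.t₁))
    {p₁ p₁' p₂ p₂' : ℝ → EuclideanSpace ℝ (Fin m)}
    (hp₁ : ∀ t ∈ Icc G.t₀ G.t₁, HasDerivWithinAt p₁ (p₁' t) (Icc G.t₀ G.t₁) t)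
    (hp₁c : ContinuousOn p₁' (Icc G.t₀ G.t₁))
    (hp₁' : ∀ t ∈ Icc G.t₀ G.t₁, ∀ z, inner ℝ (p₁' t) z =
      -(inner ℝ (p₁ t) (fx (t, x t, G.value u t i) z)) - l₁x (t, x t, G.value u t i) z)
    (hp₁b : ∀ z, inner ℝ (p₁ G.t₁) z = Ψ₁ z)
    (hp₂ : ∀ t ∈ Icc G.t₀ G.t₁, HasDerivWithinAt p₂ (p₂' t) (Icc G.t₀ G.t₁) t)
    (hp₂c : ContinuousOn p₂' (Icc G.t₀ G.t₁))
    (hp₂' : ∀ t ∈ Icc G.t₀ G.t₁, ∀ z, inner ℝ (p₂' t) z =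
      -(inner ℝ (p₂ t) (fx (t, x t, G.value u t i) z)) - l₂x (t, x t, G.value u t i) z)
    (hp₂b : ∀ z, inner ℝ (p₂ G.t₁) z = Ψ₂ z)
    {g₁ g₂ : C(Icc G.t₀ G.t₁, EuclideanSpace ℝ (Fin (d i)))}
    (hg₁ : ∀ t : Icc G.t₀ G.t₁, g₁ t = controlGradient (l₁w (t, x t, G.value u t i))
      (fw (t, x t, G.value u t i)) (p₁ t))
    (hg₂ : ∀ t : Icc G.t₀ G.t₁, g₂ t = controlGradient (l₂w (t, x t, G.value u t i))
      (fw (t, x t, G.value u t i)) (p₂ t))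
    (v : C(Icc G.t₀ G.t₁, EuclideanSpace ℝ (Fin (d i)))) :
    ¬(0 < pairing G.t₀_lt_t₁.le g₁ v ∧ 0 < pairing G.t₀_lt_t₁.le g₂ v) := by
  intro hv
  have hab := G.t₀_lt_t₁.le
  obtain ⟨-, hx, hPN⟩ := heq
  obtain ⟨v', ⟨hv₁, hv₂⟩, hfeas⟩ := hu.inter_open_nonempty
    {v | 0 < pairing hab g₁ v ∧ 0 < pairing hab g₂ v}
    ((isOpen_lt continuous_const (continuous_pairing hab g₁)).inter
      (isOpen_lt continuous_const (continuous_pairing hab g₂))) ⟨v, hv⟩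
  obtain ⟨δ₀, hδ₀, H₀⟩ := mem_nhdsGT_iff_exists_Ioc_subset.1 hfeas
  replace hδ₀ : 0 < δ₀ := hδ₀
  set ω : ℝ → EuclideanSpace ℝ (Fin (d i)) := fun t => G.value u t i with hω
  set η : ℝ → EuclideanSpace ℝ (Fin (d i)) := fun t => v' (projIcc G.t₀ G.t₁ hab t) with hη
  have hωc : ContinuousOn ω (Icc G.t₀ G.t₁) :=
    ((u i).continuous.comp continuous_projIcc).continuousOn
  have hηc : ContinuousOn η (Icc G.t₀ G.t₁) :=
    (v'.continuous.comp continuous_projIcc).continuousOn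
  have hωu : ∀ t, Function.update (G.value u t) i (ω t) = G.value u t := fun t =>
    Function.update_eq_self _ _
  have hval : ∀ (s t : ℝ), G.value (Function.update u i (u i + s • v')) t
      = Function.update (G.value u t) i (ω t + s • η t) := fun s t => by
    rw [value_update]
    rfl
  have hfc := continuousOn_comp_update hf (G.continuous_value u) i
  have hxs : ∀ t ∈ Icc G.t₀ G.t₁, HasDerivWithinAt x
      (G.f t (x t) (Function.update (G.value u t) i (ω t))) (Icc G.t₀ G.t₁) t := fun t ht => by
    rw [hωu]
    exact hx.2 t ht
  have hxc : ContinuousOn x (Icc G.t₀ G.t₁) := fun t ht => (hxs t ht).continuousWithinAt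
  have hLx := hint i x hxc u
  obtain ⟨C, δ, hC, hδ, H⟩ := exists_perturbed_state hab hfc hf' hωc hηc hxs
  obtain ⟨δ₁, hδ₁, H₁⟩ := exists_first_variation_bound hab hfc hf' hl₁ hωc hηc hxs
    (by simpa only [hωu] using hLx.1) hΨ₁ hp₁ hp₁c hp₁' hp₁b hC (half_pos hv₁)
  obtain ⟨δ₂, hδ₂, H₂⟩ := exists_first_variation_bound hab hfc hf' hl₂ hωc hηc hxs
    (by simpa only [hωu] using hLx.2) hΨ₂ hp₂ hp₂c hp₂' hp₂b hC (half_pos hv₂)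
  have hpair : ∀ (lw : ℝ × EuclideanSpace ℝ (Fin m) × EuclideanSpace ℝ (Fin (d i)) →
        EuclideanSpace ℝ (Fin (d i)) →L[ℝ] ℝ) (p : ℝ → EuclideanSpace ℝ (Fin m))
      (g : C(Icc G.t₀ G.t₁, EuclideanSpace ℝ (Fin (d i)))),
      (∀ t : Icc G.t₀ G.t₁, g t = controlGradient (lw ((t : ℝ), x t, ω t))
        (fw ((t : ℝ), x t, ω t)) (p t)) →
      ∫ t in G.t₀..G.t₁, (lw (t, x t, ω t) (η t) + inner ℝ (p t) (fw (t, x t, ω t) (η t)))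
        = pairing hab g v' := by
    intro lw p g hg
    rw [pairing_apply]
    refine intervalIntegral.integral_congr fun t ht => ?_
    rw [uIcc_of_le hab] at ht
    simp only [projIcc_of_mem hab ht, hg, inner_controlGradient, hη]
  rw [hpair _ _ _ hg₁] at H₁
  rw [hpair _ _ _ hg₂] at H₂
  simp only [hωu, ← hval] at H H₁ H₂
  set s := min δ₀ (min δ (min δ₁ δ₂)) with hs
  have hs0 : 0 < s := by positivity
  obtain ⟨y, hya, hy, hyC⟩ := H s hs0 ((min_le_right _ _).trans (min_le_left _ _))
  have hLy := hint i y (fun t ht => (hy t ht).continuousWithinAt)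
    (Function.update u i (u i + s • v'))
  have K₁ := H₁ s hs0
    ((min_le_right _ _).trans ((min_le_right _ _).trans (min_le_left _ _))) y hya hy hyC hLy.1
  have K₂ := H₂ s hs0
    ((min_le_right _ _).trans ((min_le_right _ _).trans (min_le_right _ _))) y hya hy hyC hLy.2
  rw [← lowerPayoff_eq G i _ y hLy.1, ← lowerPayoff_eq G i u x hLx.1, abs_le] at K₁
  rw [← upperPayoff_eq G i _ y hLy.2, ← upperPayoff_eq G i u x hLx.2, abs_le] at K₂
  have hv₁s : 0 < pairing hab g₁ v' * s := mul_pos hv₁ hs0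
  have hv₂s : 0 < pairing hab g₂ v' * s := mul_pos hv₂ hs0
  rcases hPN i _ (H₀ ⟨hs0, min_le_left _ _⟩) y ⟨hya.trans hx.1, hy⟩ with h | h
  · linarith [K₁.1]
  · linarith [K₂.1]

/-- The necessary conditions for player `i`, with the interval-valued gradients made explicit. -/
theorem exists_costate (G : Game n m d)
    (hf : ContinuousOn
      (fun z : ℝ × EuclideanSpace ℝ (Fin m) × Controls d => G.f z.1 z.2.1 z.2.2)
      (Icc G.t₀ G.t₁ ×ˢ univ))
    (hf' : HasContinuousPartials (Icc G.t₀ G.t₁) G.f) (i : Fin n)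
    (hL_lower : HasContinuousPartials (Icc G.t₀ G.t₁) (fun t x u => (G.L i t x u).fst))
    (hL_upper : HasContinuousPartials (Icc G.t₀ G.t₁) (fun t x u => (G.L i t x u).snd))
    (hint : G.PayoffsIntegrable) {u : G.Profile} {x : ℝ → EuclideanSpace ℝ (Fin m)}
    (hψ : EDifferentiableAt (G.ψ i) (x G.t₁)) (heq : G.IsParetoNash u x)
    (hu : G.ControlUnconstrainedAt i (u i)) :
    ∃ p : ℝ → EuclideanSpace ℝ (Fin m),
      ContDiffOn ℝ 1 p (Icc G.t₀ G.t₁) ∧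
      (∀ t ∈ Icc G.t₀ G.t₁, ∃ A : Fin m → NonemptyInterval ℝ,
        HasGHGradientAt (fun y => G.hamiltonian i t y (G.value u t) (p t)) A (x t) ∧
        ∀ j, (derivWithin p (Icc G.t₀ G.t₁) t) j ∈ -(A j)) ∧
      (∀ t ∈ Icc G.t₀ G.t₁, ∃ B : Fin (d i) → NonemptyInterval ℝ,
        HasGHGradientAt
          (fun w => G.hamiltonian i t (x t) (Function.update (G.value u t) i w) (p t)) B
          (G.value u t i) ∧
        ∀ j, (0 : ℝ) ∈ B j) ∧
      ∃ C : Fin m → NonemptyInterval ℝ,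
        HasGHGradientAt (G.ψ i) C (x G.t₁) ∧ ∀ j, (p G.t₁) j ∈ C j := by
  have hab := G.t₀_lt_t₁.le
  have hUc := G.continuous_value u
  obtain ⟨fx, fw, hf'i⟩ := hf'.exists_hasPartials hUc i
  obtain ⟨l₁x, l₁w, hl₁⟩ := hL_lower.exists_hasPartials hUc i
  obtain ⟨l₂x, l₂w, hl₂⟩ := hL_upper.exists_hasPartials hUc i
  obtain ⟨⟨Ψ₁, hΨ₁⟩, ⟨Ψ₂, hΨ₂⟩⟩ := hψ
  have hxc : ContinuousOn x (Icc G.t₀ G.t₁) := fun t ht => (heq.2.1.2 t ht).continuousWithinAt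
  have hωc : ContinuousOn (fun t => G.value u t i) (Icc G.t₀ G.t₁) :=
    ((continuous_apply i).comp hUc).continuousOn
  have hfxc := continuousOn_along hf'i.continuousOn_left hxc hωc
  have hfwc := continuousOn_along hf'i.continuousOn_right hxc hωc
  obtain ⟨p₁, p₁', hp₁, hp₁c, hp₁', hp₁b⟩ := exists_adjoint_trajectory hab hfxc
    (continuousOn_along hl₁.continuousOn_left hxc hωc) Ψ₁
  obtain ⟨p₂, p₂', hp₂, hp₂c, hp₂', hp₂b⟩ := exists_adjoint_trajectory hab hfxc
    (continuousOn_along hl₂.continuousOn_left hxc hωc) Ψ₂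
  have hg₁c := continuousOn_controlGradient
    (continuousOn_along hl₁.continuousOn_right hxc hωc) hfwc
    fun t ht => (hp₁ t ht).continuousWithinAt
  have hg₂c := continuousOn_controlGradient
    (continuousOn_along hl₂.continuousOn_right hxc hωc) hfwc
    fun t ht => (hp₂ t ht).continuousWithinAt
  obtain ⟨g₁, hg₁⟩ : ∃ g : C(Icc G.t₀ G.t₁, EuclideanSpace ℝ (Fin (d i))),
      ∀ t : Icc G.t₀ G.t₁, g t = controlGradient (l₁w (t, x t, G.value u t i))
        (fw (t, x t, G.value u t i)) (p₁ t) :=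
    ⟨⟨_, continuousOn_iff_continuous_domRestrict.1 hg₁c⟩, fun _ => rfl⟩
  obtain ⟨g₂, hg₂⟩ : ∃ g : C(Icc G.t₀ G.t₁, EuclideanSpace ℝ (Fin (d i))),
      ∀ t : Icc G.t₀ G.t₁, g t = controlGradient (l₂w (t, x t, G.value u t i))
        (fw (t, x t, G.value u t i)) (p₂ t) :=
    ⟨⟨_, continuousOn_iff_continuous_domRestrict.1 hg₂c⟩, fun _ => rfl⟩
  obtain ⟨c, hc0, hc1, hc⟩ := exists_convexCombination_eq_zero (pairing hab g₁) (pairing hab g₂)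
    (not_both_pairings_pos G i heq hu hint hf hf'i hl₁ hl₂ hΨ₁ hΨ₂ hp₁ hp₁c hp₁' hp₁b
      hp₂ hp₂c hp₂' hp₂b hg₁ hg₂)
  have hzero : c • g₁ + (1 - c) • g₂ = 0 := by
    refine eq_zero_of_pairing_self G.t₀_lt_t₁ ?_
    rw [← hc (c • g₁ + (1 - c) • g₂), pairing_comm hab g₁, pairing_comm hab g₂, map_add, map_smul,
      map_smul, smul_eq_mul, smul_eq_mul]
  have hgrad : ∀ t ∈ Icc G.t₀ G.t₁, ∀ w,
      c * l₁w (t, x t, G.value u t i) w + (1 - c) * l₂w (t, x t, G.value u t i) w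
        + inner ℝ (c • p₁ t + (1 - c) • p₂ t) (fw (t, x t, G.value u t i) w) = 0 := by
    intro t ht w
    have h : c • g₁ ⟨t, ht⟩ + (1 - c) • g₂ ⟨t, ht⟩ = 0 := DFunLike.congr_fun hzero ⟨t, ht⟩
    rw [hg₁, hg₂] at h
    have h' := congrArg (fun z => inner ℝ z w) h
    simp only [inner_add_left, real_inner_smul_left, inner_controlGradient, inner_zero_left] at h'
    simp only [inner_add_left, real_inner_smul_left]
    linarith
  have hωu : ∀ t, Function.update (G.value u t) i (G.value u t i) = G.value u t := fun t =>
    Function.update_eq_self _ _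
  have hp : ∀ t ∈ Icc G.t₀ G.t₁, HasDerivWithinAt (fun t => c • p₁ t + (1 - c) • p₂ t)
      (c • p₁' t + (1 - c) • p₂' t) (Icc G.t₀ G.t₁) t :=
    fun t ht => ((hp₁ t ht).const_smul c).add ((hp₂ t ht).const_smul (1 - c))
  have hpd : ∀ t ∈ Icc G.t₀ G.t₁, derivWithin (fun t => c • p₁ t + (1 - c) • p₂ t)
      (Icc G.t₀ G.t₁) t = c • p₁' t + (1 - c) • p₂' t :=
    fun t ht => (hp t ht).derivWithin (uniqueDiffOn_Icc G.t₀_lt_t₁ t ht)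
  have hcoord : ∀ {k : ℕ} (z : EuclideanSpace ℝ (Fin k)) (j : Fin k),
      z j = inner ℝ z (EuclideanSpace.single j 1) := fun z j => by
    simp [EuclideanSpace.inner_single_right]
  refine ⟨fun t => c • p₁ t + (1 - c) • p₂ t, ?_, fun t ht => ⟨_,
    hasGHGradientAt_of_hasFDerivAt
      (G.hasFDerivAt_hamiltonian_fst i t _ (y := fun y => y) (w := fun _ => G.value u t)
        (by simpa only [hωu] using hl₁.hasFDerivAt_left t ht (x t) (G.value u t i))
        (by simpa only [hωu] using hf'i.hasFDerivAt_left t ht (x t) (G.value u t i)))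
      (G.hasFDerivAt_hamiltonian_snd i t _ (y := fun y => y) (w := fun _ => G.value u t)
        (by simpa only [hωu] using hl₂.hasFDerivAt_left t ht (x t) (G.value u t i))
        (by simpa only [hωu] using hf'i.hasFDerivAt_left t ht (x t) (G.value u t i))),
    fun j => ?_⟩, fun t ht => ⟨_, hasGHGradientAt_of_hasFDerivAt
      (G.hasFDerivAt_hamiltonian_fst i t _ (y := fun _ => x t)
        (hl₁.hasFDerivAt_right t ht (x t) (G.value u t i))
        (hf'i.hasFDerivAt_right t ht (x t) (G.value u t i)))
      (G.hasFDerivAt_hamiltonian_snd i t _ (y := fun _ => x t)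
        (hl₂.hasFDerivAt_right t ht (x t) (G.value u t i))
        (hf'i.hasFDerivAt_right t ht (x t) (G.value u t i))), fun j => ?_⟩,
    ⟨_, hasGHGradientAt_of_hasFDerivAt hΨ₁ hΨ₂, fun j => ?_⟩⟩
  · rw [contDiffOn_one_iff_derivWithin (uniqueDiffOn_Icc G.t₀_lt_t₁)]
    exact ⟨fun t ht => (hp t ht).differentiableWithinAt,
      ((hp₁c.const_smul c).add (hp₂c.const_smul (1 - c))).congr hpd⟩
  · rw [hpd t ht, ← neg_neg ((c • p₁' t + (1 - c) • p₂' t) j), neg_mem_neg_iff]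
    convert convexCombination_mem_hull hc0 hc1 _ _ using 1
    rw [hcoord]
    simp only [add_apply, ContinuousLinearMap.comp_apply, innerSL_apply_apply,
      inner_add_left, real_inner_smul_left, hp₁' t ht, hp₂' t ht]
    ring
  · convert convexCombination_mem_hull hc0 hc1 _ _ using 1
    rw [← hgrad t ht (EuclideanSpace.single j 1)]
    simp only [add_apply, ContinuousLinearMap.comp_apply, innerSL_apply_apply]
    ring
  · convert convexCombination_mem_hull hc0 hc1 _ _ using 1
    rw [hcoord]
    simp only [inner_add_left, real_inner_smul_left, hp₁b, hp₂b]

end Game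

end IntervalGame

theorem theorem4p3 {n m : ℕ} {d : Fin n → ℕ} (G : IntervalGame.Game n m d)
    (hf : ContinuousOn
      (fun z : ℝ × EuclideanSpace ℝ (Fin m) × IntervalGame.Controls d => G.f z.1 z.2.1 z.2.2)
      (Set.Icc G.t₀ G.t₁ ×ˢ Set.univ))
    (hf' : IntervalGame.HasContinuousPartials (Set.Icc G.t₀ G.t₁) G.f)
    (hL_lower : ∀ i, IntervalGame.HasContinuousPartials (Set.Icc G.t₀ G.t₁)
      (fun t x u => (G.L i t x u).fst))
    (hL_upper : ∀ i, IntervalGame.HasContinuousPartials (Set.Icc G.t₀ G.t₁)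
      (fun t x u => (G.L i t x u).snd))
    (hL_int : G.PayoffsIntegrable)
    (hψ : ∀ i x, IntervalGame.EDifferentiableAt (G.ψ i) x)
    (u : G.Profile) (x : ℝ → EuclideanSpace ℝ (Fin m))
    (heq : G.IsParetoNash u x)
    (hu : ∀ i, G.ControlUnconstrainedAt i (u i)) :
    ∃ p : Fin n → ℝ → EuclideanSpace ℝ (Fin m),
      (∀ i, ContDiffOn ℝ 1 (p i) (Set.Icc G.t₀ G.t₁)) ∧
      G.IsState u x ∧
      (∀ i, ∀ t ∈ Set.Icc G.t₀ G.t₁, ∃ A : Fin m → NonemptyInterval ℝ,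
        IntervalGame.HasGHGradientAt
          (fun y => G.hamiltonian i t y (G.value u t) (p i t)) A (x t) ∧
        ∀ j, (derivWithin (p i) (Set.Icc G.t₀ G.t₁) t) j ∈ -(A j)) ∧
      (∀ i, ∀ t ∈ Set.Icc G.t₀ G.t₁, ∃ B : Fin (d i) → NonemptyInterval ℝ,
        IntervalGame.HasGHGradientAt
          (fun w => G.hamiltonian i t (x t) (Function.update (G.value u t) i w) (p i t)) B
          (G.value u t i) ∧
        ∀ j, (0 : ℝ) ∈ B j) ∧
      (∀ i, ∃ C : Fin m → NonemptyInterval ℝ,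
        IntervalGame.HasGHGradientAt (G.ψ i) C (x G.t₁) ∧ ∀ j, (p i G.t₁) j ∈ C j) := by
  choose p hp hA hB hC using fun i => G.exists_costate hf hf' i (hL_lower i) (hL_upper i) hL_int
    (hψ i (x G.t₁)) heq (hu i)
  exact ⟨p, hp, heq.2.1, hA, hB, hC⟩
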